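/- Let $(M,g)$ be a smooth $4$-dimensional Lorentzian manifold of signature $(+,-,-,-)$ with Levi-Civita connection $\nabla$, let $e_{\hat 0},\dots,e_{\hat 3}$ be a smooth orthonormal frame on $M$, and let $l,n,m,\bar m$ be the associated null tetrad, i.e. $$e_{\hat 0}=\tfrac{1}{\sqrt2}(l+n),\quad e_{\hat 1}=\tfrac{1}{\sqrt2}(m+\bar m),\quad e_{\hat 2}=\tfrac{i}{\sqrt2}(m-\bar m),\quad e_{\hat 3}=\tfrac{1}{\sqrt2}(l-n).$$ Let $D=l^a\nabla_a$, $\Delta=n^a\nabla_a$, $\delta=m^a\nabla_a$, $\bar\delta=\bar m^a\nabla_a$, and let $\rho=m^a\bar\delta l_a$, $\tau=m^a\Delta l_a$, $\pi=-\bar m^aDn_a$, $\mu=-\bar m^a\delta n_a$, $\alpha=\tfrac12(n^a\bar\delta l_a-\bar m^a\bar\delta m_a)$ be Newman–Penrose spin coefficients. Let $M_0\in\mathbb R$ be the mass and let $A^a=\sum_i A^{\hat i}e_{\hat i}^{\;a}$ be a smooth real vector field. Then: 1. $A^a=\xi l^a+\eta n^a+\bar\zeta m^a+\zeta\bar m^a$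 with $\xi,\eta$ real and $\zeta$ complex holds if and only if $\xi=\tfrac{1}{\sqrt2}(A^{\hat 0}+A^{\hat 3})$, $\eta=\tfrac{1}{\sqrt2}(A^{\hat 0}-A^{\hat 3})$ and $\zeta=\tfrac{1}{\sqrt2}(A^{\hat 1}-iA^{\hat 2})$. 2. Suppose $\nabla l=0$, and put $$L=D\Delta+\Delta D-\delta\bar\delta-\bar\delta\delta+(\mu+\bar\mu)D+(2\alpha-\pi)\delta+(2\bar\alpha-\bar\pi)\bar\delta+M_0^2 .$$ Then $l_a(\nabla^b\nabla_bA^a+M_0^2A^a)=L\eta$ with $\eta=\tfrac{1}{\sqrt2}(A^{\hat 0}-A^{\hat 3})$. Consequently the decoupled equation $L(A^{\hat 0}-A^{\hat 3})=0$ holds if $\nabla^b\nabla_bA^a+M_0^2A^a=0$; it also holds if $M_0\neq0$ and $A$ satisfies the Proca equation $\nabla_bf^{ba}+M_0^2A^a=0$, where $f_{ab}=\nabla_aA_b-\nabla_bA_a$. 3. Suppose $\nabla n=0$, and put $$L'=D\Delta+\Delta D-\delta\bar\delta-\bar\delta\delta-(\rho+\bar\rho)\Delta+(2\alpha+\bar\tau)\delta+(2\bar\alpha+\tau)\bar\delta+M_0^2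 .$$ Then $n_a(\nabla^b\nabla_bA^a+M_0^2A^a)=L'\xi$ with $\xi=\tfrac{1}{\sqrt2}(A^{\hat 0}+A^{\hat 3})$. Consequently the decoupled equation $L'(A^{\hat 0}+A^{\hat 3})=0$ holds if $\nabla^b\nabla_bA^a+M_0^2A^a=0$; it also holds if $M_0\neq0$ and $A$ satisfies the Proca equation $\nabla_bf^{ba}+M_0^2A^a=0$. -/

import Mathlib

open scoped Manifold ContDiff Bundle

noncomputable section

namespace ProcaNP

/-! ### Lorentzian 4-manifolds and their Levi-Civita connection -/

/-- Real vector fields (no regularity imposed) on a 4-manifold. -/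
abbrev VField (M : Type*) [TopologicalSpace M] [ChartedSpace (EuclideanSpace ℝ (Fin 4)) M] :=
  Π x : M, TangentSpace (𝓡 4) x

/-- Covariant derivatives on the tangent bundle of a 4-manifold.
For `cov : Connection M`, the vector `∇_v Y` at `x` is `cov Y x v`. -/
abbrev Connection (M : Type*) [TopologicalSpace M] [ChartedSpace (EuclideanSpace ℝ (Fin 4)) M]
    [IsManifold (𝓡 4) ∞ M] :=
  CovariantDerivative (𝓡 4) (EuclideanSpace ℝ (Fin 4)) (TangentSpace (𝓡 4) : M → Type _)

section

variable {M : Type*} [TopologicalSpace M] [ChartedSpace (EuclideanSpace ℝ (Fin 4)) M]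
  [IsManifold (𝓡 4) ∞ M]

/-- A vector field is differentiable at a point. -/
def DiffVFieldAt (X : VField M) (x : M) : Prop :=
  MDifferentiableAt (𝓡 4) (𝓡 4).tangent (fun y ↦ (⟨y, X y⟩ : TangentBundle (𝓡 4) M)) x

/-- A vector field is smooth. -/
def SmoothVField (X : VField M) : Prop :=
  ContMDiff (𝓡 4) (𝓡 4).tangent ∞ (fun x ↦ (⟨x, X x⟩ : TangentBundle (𝓡 4) M))

/-- The signs `(+,-,-,-)`. -/
def sgn (i : Fin 4) : ℝ := if i = 0 then 1 else -1

end

/-- A smooth Lorentzian metric of signature `(+,-,-,-)` on a 4-manifold. -/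
structure LorentzMetric (M : Type*) [TopologicalSpace M]
    [ChartedSpace (EuclideanSpace ℝ (Fin 4)) M] [IsManifold (𝓡 4) ∞ M] where
  /-- The bilinear form on each tangent space. -/
  val : Π x : M, TangentSpace (𝓡 4) x →L[ℝ] TangentSpace (𝓡 4) x →L[ℝ] ℝ
  symm : ∀ (x : M) (v w : TangentSpace (𝓡 4) x), val x v w = val x w v
  signature : ∀ x : M, ∃ b : Module.Basis (Fin 4) ℝ (TangentSpace (𝓡 4) x),
    ∀ i j, val x (b i) (b j) = if i = j then sgn i else 0
  smooth : ContMDiff (𝓡 4)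
    ((𝓡 4).prod 𝓘(ℝ, EuclideanSpace ℝ (Fin 4) →L[ℝ] EuclideanSpace ℝ (Fin 4) →L[ℝ] ℝ)) ∞
    (fun x ↦ Bundle.TotalSpace.mk'
      (EuclideanSpace ℝ (Fin 4) →L[ℝ] EuclideanSpace ℝ (Fin 4) →L[ℝ] ℝ) x (val x))

variable {M : Type*} [TopologicalSpace M] [ChartedSpace (EuclideanSpace ℝ (Fin 4)) M]
  [IsManifold (𝓡 4) ∞ M]

/-- `∇` is the Levi-Civita connection of `g`: a smooth connection that is torsion-free and
satisfies `v (g(Y, Z)) = g(∇_v Y, Z) + g(Y, ∇_v Z)`. -/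
structure IsLeviCivita (g : LorentzMetric M) (cov : Connection M) : Prop where
  smooth : cov.ContMDiffCovariantDerivative ∞
  torsion_free : cov.torsion = 0
  metric : ∀ (Y Z : VField M) (x : M), DiffVFieldAt Y x → DiffVFieldAt Z x →
    ∀ v : TangentSpace (𝓡 4) x,
      mvfderiv (𝓡 4) (fun y ↦ g.val y (Y y) (Z y)) x v
        = g.val x (cov Y x v) (Z x) + g.val x (Y x) (cov Z x v)

/-- A smooth frame `e₀, e₁, e₂, e₃` that is orthonormal for `g`. -/
structure IsOrthonormalFrame (g : LorentzMetric M) (e : Fin 4 → VField M) : Prop where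
  smooth : ∀ i, SmoothVField (e i)
  orthonormal : ∀ x i j, g.val x (e i x) (e j x) = if i = j then sgn i else 0

/-- The vector field `X` is covariantly constant, `∇X = 0`. -/
def IsParallel (cov : Connection M) (X : VField M) : Prop :=
  ∀ x, cov X x = 0

/-! ### The Proca equation

Indices are contracted with `g^{ab} = ∑ᵢ sgn(i) eᵢ^a eᵢ^b`, for an orthonormal frame `e`. -/

/-- The vector field `∇^b ∇_b A^a`; the second covariant derivative is
`(∇²A)(X, Y) = ∇_X (∇_Y A) - ∇_{∇_X Y} A`. -/
def waveOp (cov : Connection M) (e : Fin 4 → VField M) (A : VField M) : VField M := fun x ↦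
  ∑ i, sgn i • (cov (fun y ↦ cov A y (e i y)) x (e i x) - cov A x (cov (e i) x (e i x)))

/-- The Proca bivector `f_{ab} = ∇_a A_b - ∇_b A_a`. -/
def bivector (g : LorentzMetric M) (cov : Connection M) (A : VField M) (x : M)
    (v w : TangentSpace (𝓡 4) x) : ℝ :=
  g.val x (cov A x v) w - g.val x (cov A x w) v

/-- The covariant derivative `(∇_X f)(Y, Z) = X(f(Y, Z)) - f(∇_X Y, Z) - f(Y, ∇_X Z)` of the
bivector of `A`. -/
def covBivector (g : LorentzMetric M) (cov : Connection M) (A X Y Z : VField M) (x : M) : ℝ :=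
  mvfderiv (𝓡 4) (fun y ↦ bivector g cov A y (Y y) (Z y)) x (X x)
    - bivector g cov A x (cov Y x (X x)) (Z x)
    - bivector g cov A x (Y x) (cov Z x (X x))

/-- The Proca equation `∇_a f^{ab} + mass² A^b = 0`, contracted with arbitrary smooth `Y_b`. -/
def IsProcaField (g : LorentzMetric M) (cov : Connection M) (e : Fin 4 → VField M) (mass : ℝ)
    (A : VField M) : Prop :=
  ∀ Y : VField M, SmoothVField Y → ∀ x,
    (∑ i, sgn i * covBivector g cov A (e i) (e i) Y x) + mass ^ 2 * g.val x (A x) (Y x) = 0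

/-- The massive wave equation `∇^b ∇_b A^a + mass² A^a = 0`. -/
def IsMassiveWave (cov : Connection M) (e : Fin 4 → VField M) (mass : ℝ) (A : VField M) : Prop :=
  ∀ x, waveOp cov e A x + mass ^ 2 • A x = 0

/-! ### Complex vector fields -/

/-- A complex vector field `re + i im`. -/
@[ext]
structure CField (M : Type*) [TopologicalSpace M]
    [ChartedSpace (EuclideanSpace ℝ (Fin 4)) M] where
  /-- The real part. -/
  re : VField M
  /-- The imaginary part. -/
  im : VField M

/-- A real vector field as a complex one. -/
def CField.ofReal (X : VField M) : CField M := ⟨X, fun _ ↦ 0⟩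

/-- Complex conjugation. -/
def CField.conj (Z : CField M) : CField M := ⟨Z.re, fun x ↦ -Z.im x⟩

/-- Sum of complex vector fields. -/
def CField.add (Z W : CField M) : CField M :=
  ⟨fun x ↦ Z.re x + W.re x, fun x ↦ Z.im x + W.im x⟩

/-- Product of a complex function and a complex vector field. -/
def CField.smul (φ : M → ℂ) (Z : CField M) : CField M :=
  ⟨fun x ↦ (φ x).re • Z.re x - (φ x).im • Z.im x,
    fun x ↦ (φ x).re • Z.im x + (φ x).im • Z.re x⟩

/-- The complex-bilinear extension of the metric. -/
def cinner (g : LorentzMetric M) (Z W : CField M) (x : M) : ℂ :=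
  ⟨g.val x (Z.re x) (W.re x) - g.val x (Z.im x) (W.im x),
    g.val x (Z.re x) (W.im x) + g.val x (Z.im x) (W.re x)⟩

/-- The complex-bilinear extension `∇_Z W` of the covariant derivative. -/
def ccov (cov : Connection M) (Z W : CField M) : CField M :=
  ⟨fun x ↦ cov W.re x (Z.re x) - cov W.im x (Z.im x),
    fun x ↦ cov W.im x (Z.re x) + cov W.re x (Z.im x)⟩

/-- The derivative `Z φ` of a complex function along a complex vector field. -/
def dirDeriv (Z : CField M) (φ : M → ℂ) : M → ℂ := fun x ↦
  mvfderiv (𝓡 4) φ x (Z.re x) + Complex.I * mvfderiv (𝓡 4) φ x (Z.im x)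

/-! ### The null tetrad of an orthonormal frame

It is determined by `e₀ = (l + n)/√2`, `e₁ = (m + m̄)/√2`, `e₂ = i(m - m̄)/√2`,
`e₃ = (l - n)/√2`. -/

/-- `l = (e₀ + e₃)/√2`. -/
def tetL (e : Fin 4 → VField M) : VField M := fun x ↦ (√2)⁻¹ • (e 0 x + e 3 x)

/-- `n = (e₀ - e₃)/√2`. -/
def tetN (e : Fin 4 → VField M) : VField M := fun x ↦ (√2)⁻¹ • (e 0 x - e 3 x)

/-- `m = (e₁ - i e₂)/√2`. -/
def tetM (e : Fin 4 → VField M) : CField M :=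
  ⟨fun x ↦ (√2)⁻¹ • e 1 x, fun x ↦ -((√2)⁻¹ • e 2 x)⟩

/-- `l` as a complex vector field. -/
def cL (e : Fin 4 → VField M) : CField M := CField.ofReal (tetL e)

/-- `n` as a complex vector field. -/
def cN (e : Fin 4 → VField M) : CField M := CField.ofReal (tetN e)

/-- `m̄`. -/
def tetMbar (e : Fin 4 → VField M) : CField M := (tetM e).conj

/-- `D = l^a ∇_a` on scalars. -/
def opD (e : Fin 4 → VField M) : (M → ℂ) → M → ℂ := dirDeriv (cL e)

/-- `Δ = n^a ∇_a` on scalars. -/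
def opDelta (e : Fin 4 → VField M) : (M → ℂ) → M → ℂ := dirDeriv (cN e)

/-- `δ = m^a ∇_a` on scalars. -/
def opdelta (e : Fin 4 → VField M) : (M → ℂ) → M → ℂ := dirDeriv (tetM e)

/-- `δ̄ = m̄^a ∇_a` on scalars. -/
def opdeltaBar (e : Fin 4 → VField M) : (M → ℂ) → M → ℂ := dirDeriv (tetMbar e)

/-! ### Newman-Penrose spin coefficients -/

/-- `ρ = m^a δ̄ l_a`. -/
def npRho (g : LorentzMetric M) (cov : Connection M) (e : Fin 4 → VField M) (x : M) : ℂ :=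
  cinner g (tetM e) (ccov cov (tetMbar e) (cL e)) x

/-- `τ = m^a Δ l_a`. -/
def npTau (g : LorentzMetric M) (cov : Connection M) (e : Fin 4 → VField M) (x : M) : ℂ :=
  cinner g (tetM e) (ccov cov (cN e) (cL e)) x

/-- `π = -m̄^a D n_a`. -/
def npPi (g : LorentzMetric M) (cov : Connection M) (e : Fin 4 → VField M) (x : M) : ℂ :=
  -cinner g (tetMbar e) (ccov cov (cL e) (cN e)) x

/-- `μ = -m̄^a δ n_a`. -/
def npMu (g : LorentzMetric M) (cov : Connection M) (e : Fin 4 → VField M) (x : M) : ℂ :=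
  -cinner g (tetMbar e) (ccov cov (tetM e) (cN e)) x

/-- `α = (n^a δ̄ l_a - m̄^a δ̄ m_a)/2`. -/
def npAlpha (g : LorentzMetric M) (cov : Connection M) (e : Fin 4 → VField M) (x : M) : ℂ :=
  (cinner g (cN e) (ccov cov (tetMbar e) (cL e)) x
    - cinner g (tetMbar e) (ccov cov (tetMbar e) (tetM e)) x) / 2

/-! ### The decoupled second-order operators -/

open ComplexConjugate in
/-- `[DΔ + ΔD - δδ̄ - δ̄δ + (μ + μ̄)D + (2α - π)δ + (2ᾱ - π̄)δ̄ + mass²] φ`. -/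
def etaOp (g : LorentzMetric M) (cov : Connection M) (e : Fin 4 → VField M) (mass : ℝ)
    (φ : M → ℂ) (x : M) : ℂ :=
  opD e (opDelta e φ) x + opDelta e (opD e φ) x
    - opdelta e (opdeltaBar e φ) x - opdeltaBar e (opdelta e φ) x
    + (npMu g cov e x + conj (npMu g cov e x)) * opD e φ x
    + (2 * npAlpha g cov e x - npPi g cov e x) * opdelta e φ x
    + (2 * conj (npAlpha g cov e x) - conj (npPi g cov e x)) * opdeltaBar e φ x
    + (mass : ℂ) ^ 2 * φ x

open ComplexConjugate in
/-- `[DΔ + ΔD - δδ̄ - δ̄δ - (ρ + ρ̄)Δ + (2α + τ̄)δ + (2ᾱ + τ)δ̄ + mass²] φ`. -/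
def xiOp (g : LorentzMetric M) (cov : Connection M) (e : Fin 4 → VField M) (mass : ℝ)
    (φ : M → ℂ) (x : M) : ℂ :=
  opD e (opDelta e φ) x + opDelta e (opD e φ) x
    - opdelta e (opdeltaBar e φ) x - opdeltaBar e (opdelta e φ) x
    - (npRho g cov e x + conj (npRho g cov e x)) * opDelta e φ x
    + (2 * npAlpha g cov e x + conj (npTau g cov e x)) * opdelta e φ x
    + (2 * conj (npAlpha g cov e x) + npTau g cov e x) * opdeltaBar e φ x
    + (mass : ℂ) ^ 2 * φ x

open ComplexConjugate in
/-- `A = ξ l + η n + ζ̄ m + ζ m̄`. -/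
def IsNPDecomposition (e : Fin 4 → VField M) (A : VField M) (ξ η : M → ℝ) (ζ : M → ℂ) : Prop :=
  CField.ofReal A =
    (((CField.smul (fun x ↦ (ξ x : ℂ)) (cL e)).add
      (CField.smul (fun x ↦ (η x : ℂ)) (cN e))).add
      (CField.smul (fun x ↦ conj (ζ x)) (tetM e))).add
      (CField.smul ζ (tetMbar e))

end ProcaNP

end

/-! A parallel field `Y` passes through every covariant derivative, so contracting `∇^b ∇_b A^a`
with `Y_a` gives the scalar d'Alembertian of `g(Y, A)` (`inner_waveOp`). For `Y = l` or `Y = n` this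
scalar is `η` or `ξ`, since `l_a n^a = 1` and `l`, `n` pair to zero with `m`, `m̄` and with
themselves.

In an orthonormal frame the d'Alembertian is `∑ sgn(i) (eᵢ eᵢ φ + (div eᵢ) eᵢ φ)`. Its second-order
part is `DΔ + ΔD - δδ̄ - δ̄δ`. Its first-order part agrees with the spin-coefficient terms once the
skew-symmetry of the connection coefficients and the relations imposed by `∇l = 0` or `∇n = 0` are
used (`etaOp_ofReal`, `xiOp_ofReal`).

For a Proca field the contracted equation differs from the contracted wave equation by `div (∇_Y
A)`. As `Y` is parallel and the torsion vanishes, `∇_Y A = [Y, A]`, whose divergence is `Y (div A) -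
A (div Y)` (`divergence_bracket`). Here `div Y = 0` because `Y` is parallel, and `div A = 0` follows
from the divergence of the Proca equation when the mass is nonzero, because `∇_b ∇_a H^{ab} = 0` for
skew `H` (`divergence_skewDivergence`). Both divergence identities are derived from Lie brackets and
the Jacobi identity, so curvature never enters. -/

namespace ProcaNP

open VectorField

set_option linter.unusedSectionVars false

variable {M : Type*} [TopologicalSpace M] [ChartedSpace (EuclideanSpace ℝ (Fin 4)) M]
  [IsManifold (𝓡 4) ∞ M]

/-! ### Smooth functions and smooth vector fields -/

/-- A real function is smooth. -/
def SmoothFn (φ : M → ℝ) : Prop := ContMDiff (𝓡 4) 𝓘(ℝ, ℝ) ∞ φ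

/-- The derivative `X φ` of a real function along a vector field. -/
noncomputable def along (X : VField M) (φ : M → ℝ) : M → ℝ := fun x ↦ mvfderiv (𝓡 4) φ x (X x)

lemma SmoothVField.diffAt {X : VField M} (hX : SmoothVField X) (x : M) : DiffVFieldAt X x :=
  (hX x).mdifferentiableAt (by simp)

lemma SmoothFn.diffAt {φ : M → ℝ} (hφ : SmoothFn φ) (x : M) :
    MDifferentiableAt (𝓡 4) 𝓘(ℝ, ℝ) φ x :=
  (hφ x).mdifferentiableAt (by simp)

lemma SmoothVField.add {X Y : VField M} (hX : SmoothVField X) (hY : SmoothVField Y) :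
    SmoothVField (fun x ↦ X x + Y x) := ContMDiff.add_section hX hY

lemma SmoothVField.sub {X Y : VField M} (hX : SmoothVField X) (hY : SmoothVField Y) :
    SmoothVField (fun x ↦ X x - Y x) := ContMDiff.sub_section hX hY

lemma SmoothFn.smul {φ : M → ℝ} {X : VField M} (hφ : SmoothFn φ) (hX : SmoothVField X) :
    SmoothVField (fun x ↦ φ x • X x) := ContMDiff.smul_section hφ hX

lemma SmoothVField.sum {ι : Type*} {s : Finset ι} {X : ι → VField M}
    (hX : ∀ i, SmoothVField (X i)) : SmoothVField (fun x ↦ ∑ i ∈ s, X i x) :=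
  ContMDiff.sum_section fun i _ ↦ hX i

lemma smoothFn_const (c : ℝ) : SmoothFn (fun _ : M ↦ c) := contMDiff_const

lemma SmoothFn.add {φ ψ : M → ℝ} (hφ : SmoothFn φ) (hψ : SmoothFn ψ) :
    SmoothFn (fun x ↦ φ x + ψ x) := ContMDiff.add hφ hψ

lemma SmoothFn.sub {φ ψ : M → ℝ} (hφ : SmoothFn φ) (hψ : SmoothFn ψ) :
    SmoothFn (fun x ↦ φ x - ψ x) := ContMDiff.sub hφ hψ

lemma SmoothFn.mul {φ ψ : M → ℝ} (hφ : SmoothFn φ) (hψ : SmoothFn ψ) :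
    SmoothFn (fun x ↦ φ x * ψ x) := ContMDiff.mul hφ hψ

lemma SmoothFn.sum {ι : Type*} {s : Finset ι} {φ : ι → M → ℝ} (hφ : ∀ i, SmoothFn (φ i)) :
    SmoothFn (fun x ↦ ∑ i ∈ s, φ i x) := by
  classical
  induction s using Finset.induction_on with
  | empty => simpa using smoothFn_const 0
  | insert i s hi ih => simpa [Finset.sum_insert hi] using (hφ i).add ih

lemma SmoothVField.inner {g : LorentzMetric M} {X Y : VField M} (hX : SmoothVField X)
    (hY : SmoothVField Y) : SmoothFn (fun x ↦ g.val x (X x) (Y x)) := by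
  have h := g.smooth.clm_bundle_apply₂ (F₁ := EuclideanSpace ℝ (Fin 4))
    (F₂ := EuclideanSpace ℝ (Fin 4)) (F₃ := ℝ) (E₁ := TangentSpace (𝓡 4))
    (E₂ := TangentSpace (𝓡 4)) (E₃ := Bundle.Trivial M ℝ) hX hY
  exact fun x ↦ (Bundle.contMDiffAt_section (F := ℝ) (E := Bundle.Trivial M ℝ) x).1 (h x)

lemma SmoothVField.cov {g : LorentzMetric M} {cov : Connection M} (h : IsLeviCivita g cov)
    {X Y : VField M} (hX : SmoothVField X) (hY : SmoothVField Y) :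
    SmoothVField (fun x ↦ cov Y x (X x)) := by
  have h1 := h.smooth.contMDiff.contMDiff (σ := Y) (by simpa using hY.contMDiffOn)
  rw [contMDiffOn_univ] at h1
  exact h1.clm_bundle_apply hX

lemma SmoothVField.bracket {X Y : VField M} (hX : SmoothVField X) (hY : SmoothVField Y) :
    SmoothVField (mlieBracket (𝓡 4) X Y) := by
  -- Since `∞ + 1` is `∞`, the bracket of smooth fields loses no regularity.
  have : IsManifold (𝓡 4) (((⊤ : ℕ∞) : WithTop ℕ∞) + 1) M := ‹IsManifold (𝓡 4) ∞ M›
  have : IsManifold (𝓡 4) (minSmoothness ℝ 2) M := by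
    simp only [minSmoothness_of_isRCLikeNormedField]; infer_instance
  exact ContDiff.mlieBracket_vectorField (n := ⊤) (m := ⊤) hX hY (by simp)

lemma jacobi_mlieBracket {X Y Z : VField M} (hX : SmoothVField X) (hY : SmoothVField Y)
    (hZ : SmoothVField Z) (x : M) :
    mlieBracket (𝓡 4) X (mlieBracket (𝓡 4) Y Z) x =
      mlieBracket (𝓡 4) (mlieBracket (𝓡 4) X Y) Z x
        + mlieBracket (𝓡 4) Y (mlieBracket (𝓡 4) X Z) x := by
  have : IsManifold (𝓡 4) (minSmoothness ℝ 3) M := by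
    simp only [minSmoothness_of_isRCLikeNormedField]; infer_instance
  have h2 : (minSmoothness ℝ 2) ≤ (∞ : WithTop ℕ∞) := by
    simp only [minSmoothness_of_isRCLikeNormedField]
    exact WithTop.coe_le_coe.2 (le_top : (2 : ℕ∞) ≤ ⊤)
  exact leibniz_identity_mlieBracket_apply ((hX x).of_le h2) ((hY x).of_le h2) ((hZ x).of_le h2)

/-! ### Derivatives along vector fields -/

lemma along_add {X : VField M} {φ ψ : M → ℝ} (hφ : SmoothFn φ) (hψ : SmoothFn ψ) (x : M) :
    along X (fun y ↦ φ y + ψ y) x = along X φ x + along X ψ x := by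
  simp only [along]
  rw [mvfderiv_fun_add (hφ.diffAt x) (hψ.diffAt x)]; rfl

lemma along_sub {X : VField M} {φ ψ : M → ℝ} (hφ : SmoothFn φ) (hψ : SmoothFn ψ) (x : M) :
    along X (fun y ↦ φ y - ψ y) x = along X φ x - along X ψ x := by
  simp only [along]
  rw [mvfderiv_fun_sub (hφ.diffAt x) (hψ.diffAt x)]; rfl

lemma along_mul {X : VField M} {φ ψ : M → ℝ} (hφ : SmoothFn φ) (hψ : SmoothFn ψ) (x : M) :
    along X (fun y ↦ φ y * ψ y) x = φ x * along X ψ x + ψ x * along X φ x := by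
  simp only [along]
  rw [mvfderiv_fun_mul (hφ.diffAt x) (hψ.diffAt x)]; rfl

lemma along_const (X : VField M) (c : ℝ) (x : M) : along X (fun _ ↦ c) x = 0 := by
  simp only [along]
  rw [mvfderiv_const]; rfl

lemma along_const_mul {X : VField M} {φ : M → ℝ} (hφ : SmoothFn φ) (c : ℝ) (x : M) :
    along X (fun y ↦ c * φ y) x = c * along X φ x := by
  rw [along_mul (smoothFn_const c) hφ, along_const]; ring

lemma along_neg {X : VField M} {φ : M → ℝ} (hφ : SmoothFn φ) (x : M) :
    along X (fun y ↦ -φ y) x = -along X φ x := by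
  simpa using along_const_mul (X := X) hφ (-1) x

lemma along_sum {ι : Type*} {s : Finset ι} {X : VField M} {φ : ι → M → ℝ}
    (hφ : ∀ i, SmoothFn (φ i)) (x : M) :
    along X (fun y ↦ ∑ i ∈ s, φ i y) x = ∑ i ∈ s, along X (φ i) x := by
  classical
  induction s using Finset.induction_on with
  | empty => simpa using along_const X 0 x
  | insert i s hi ih =>
    simp only [Finset.sum_insert hi]
    rw [along_add (hφ i) (SmoothFn.sum hφ), ih]

/-! ### Lie brackets -/

lemma bracket_smul {X Y : VField M} {φ : M → ℝ} (hφ : SmoothFn φ) (hY : SmoothVField Y) (x : M) :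
    mlieBracket (𝓡 4) X (fun y ↦ φ y • Y y) x
      = along X φ x • Y x + φ x • mlieBracket (𝓡 4) X Y x :=
  mlieBracket_smul_right (hφ.diffAt x) (hY.diffAt x)

lemma bracket_add {X Y Z : VField M} (hY : SmoothVField Y) (hZ : SmoothVField Z) (x : M) :
    mlieBracket (𝓡 4) X (fun y ↦ Y y + Z y) x
      = mlieBracket (𝓡 4) X Y x + mlieBracket (𝓡 4) X Z x :=
  mlieBracket_add_right (hY.diffAt x) (hZ.diffAt x)

lemma bracket_swap (X Y : VField M) (x : M) :
    mlieBracket (𝓡 4) X Y x = -mlieBracket (𝓡 4) Y X x := by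
  rw [mlieBracket_swap]; rfl

lemma bracket_sum {ι : Type*} {s : Finset ι} {X : VField M} {Y : ι → VField M}
    (hY : ∀ i, SmoothVField (Y i)) (x : M) :
    mlieBracket (𝓡 4) X (fun y ↦ ∑ i ∈ s, Y i y) x
      = ∑ i ∈ s, mlieBracket (𝓡 4) X (Y i) x := by
  classical
  induction s using Finset.induction_on with
  | empty =>
    simp only [Finset.sum_empty]
    exact congrFun (mlieBracket_zero_right (I := 𝓡 4) (W := X)) x
  | insert i s hi ih =>
    simp only [Finset.sum_insert hi]
    rw [bracket_add (hY i) (SmoothVField.sum hY), ih]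

/-! ### The covariant derivative -/

section LeviCivita

variable {g : LorentzMetric M} {cov : Connection M}

lemma cov_add (cov : Connection M) {X Y : VField M} (hX : SmoothVField X) (hY : SmoothVField Y)
    (x : M) : cov (fun y ↦ X y + Y y) x = cov X x + cov Y x :=
  cov.isCovariantDerivativeOnUniv.add (hX.diffAt x) (hY.diffAt x)

lemma cov_smul (cov : Connection M) {X : VField M} {φ : M → ℝ} (hφ : SmoothFn φ)
    (hX : SmoothVField X) (x : M) (v : TangentSpace (𝓡 4) x) :
    cov (fun y ↦ φ y • X y) x v = φ x • cov X x v + mvfderiv (𝓡 4) φ x v • X x := by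
  have := cov.isCovariantDerivativeOnUniv.leibniz (hX.diffAt x) (hφ.diffAt x)
  exact DFunLike.congr_fun this v

lemma cov_const_smul (cov : Connection M) {X : VField M} (c : ℝ)
    (hX : SmoothVField X) (x : M) : cov (fun y ↦ c • X y) x = c • cov X x :=
  cov.isCovariantDerivativeOnUniv.smul_const c (hX.diffAt x)

lemma cov_sum (cov : Connection M) {ι : Type*} {s : Finset ι} {X : ι → VField M}
    (hX : ∀ i, SmoothVField (X i)) (x : M) :
    cov (fun y ↦ ∑ i ∈ s, X i y) x = ∑ i ∈ s, cov (X i) x := by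
  classical
  induction s using Finset.induction_on with
  | empty =>
    simp only [Finset.sum_empty]
    exact cov.isCovariantDerivativeOnUniv.zero
  | insert i s hi ih =>
    simp only [Finset.sum_insert hi]
    rw [cov_add cov (hX i) (SmoothVField.sum hX), ih]

lemma IsLeviCivita.bracket_eq (h : IsLeviCivita g cov) {X Y : VField M} (hX : SmoothVField X)
    (hY : SmoothVField Y) (x : M) :
    mlieBracket (𝓡 4) X Y x = cov Y x (X x) - cov X x (Y x) :=
  (cov.torsion_eq_zero_iff.1 h.torsion_free (hX.diffAt x) (hY.diffAt x)).symm

lemma IsLeviCivita.along_inner (h : IsLeviCivita g cov) {X Y : VField M} (hX : SmoothVField X)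
    (hY : SmoothVField Y) (Z : VField M) (x : M) :
    along Z (fun y ↦ g.val y (X y) (Y y)) x
      = g.val x (cov X x (Z x)) (Y x) + g.val x (X x) (cov Y x (Z x)) :=
  h.metric X Y x (hX.diffAt x) (hY.diffAt x) (Z x)

end LeviCivita

/-! ### Orthonormal frames -/

lemma sgn_mul_self (i : Fin 4) : sgn i * sgn i = 1 := by
  unfold sgn; split_ifs <;> norm_num

section Frame

variable {g : LorentzMetric M} {cov : Connection M} {e : Fin 4 → VField M}

lemma IsOrthonormalFrame.inner_sum (he : IsOrthonormalFrame g e) (x : M) (c : Fin 4 → ℝ)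
    (k : Fin 4) : g.val x (∑ i, c i • e i x) (e k x) = sgn k * c k := by
  simp only [map_sum, map_smul, sum_apply, smul_apply, he.orthonormal,
    smul_eq_mul, mul_ite, mul_zero, Finset.sum_ite_eq', Finset.mem_univ, if_true]
  exact mul_comm _ _

lemma IsOrthonormalFrame.coeff_ext (he : IsOrthonormalFrame g e) {x : M} {b c : Fin 4 → ℝ}
    (h : ∑ i, b i • e i x = ∑ i, c i • e i x) : b = c := by
  funext k
  have h1 := congrArg (fun v ↦ sgn k * g.val x v (e k x)) h
  simp only [he.inner_sum, ← mul_assoc, sgn_mul_self, one_mul] at h1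
  exact h1

/-- Pairing with the frame recovers coefficients, so the four vectors are independent and, by
dimension, span. The factor `sgn i` inverts `g(eᵢ, eᵢ)`. -/
lemma IsOrthonormalFrame.expand (he : IsOrthonormalFrame g e) (x : M)
    (v : TangentSpace (𝓡 4) x) : v = ∑ i, (sgn i * g.val x v (e i x)) • e i x := by
  have hli : LinearIndependent ℝ (fun i ↦ e i x) := by
    rw [Fintype.linearIndependent_iff]
    intro c hc
    have : c = 0 := he.coeff_ext (x := x) (by simpa using hc)
    simp [this]
  have hspan : ⊤ ≤ Submodule.span ℝ (Set.range fun i ↦ e i x) := by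
    have : FiniteDimensional ℝ (TangentSpace (𝓡 4) x) :=
      inferInstanceAs (FiniteDimensional ℝ (EuclideanSpace ℝ (Fin 4)))
    refine (hli.span_eq_top_of_card_eq_finrank' ?_).ge
    exact (Fintype.card_fin 4).trans (finrank_euclideanSpace_fin (𝕜 := ℝ)).symm
  obtain ⟨c, hc⟩ :=
    (Submodule.mem_span_range_iff_exists_fun ℝ).1 (hspan (Submodule.mem_top (x := v)))
  subst hc
  simp only [he.inner_sum, ← mul_assoc, sgn_mul_self, one_mul]

lemma IsOrthonormalFrame.inner_eq_sum (he : IsOrthonormalFrame g e) {x : M}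
    (T : TangentSpace (𝓡 4) x →L[ℝ] ℝ) (v : TangentSpace (𝓡 4) x) :
    T v = ∑ i, sgn i * g.val x v (e i x) * T (e i x) := by
  conv_lhs => rw [he.expand x v]
  simp [map_sum]

/-- By the Leibniz rule `[X, φ e₀] - φ [X, e₀] = (X φ) e₀`. Pairing with `e₀` exhibits `X φ` through
brackets, whose smoothness is known. -/
lemma IsOrthonormalFrame.smooth_along (he : IsOrthonormalFrame g e) {X : VField M} {φ : M → ℝ}
    (hX : SmoothVField X) (hφ : SmoothFn φ) : SmoothFn (along X φ) := by
  have h : along X φ = fun x ↦ g.val x (mlieBracket (𝓡 4) X (fun y ↦ φ y • e 0 y) x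
      - φ x • mlieBracket (𝓡 4) X (e 0) x) (e 0 x) := by
    funext x
    rw [bracket_smul hφ (he.smooth 0)]
    simp [he.orthonormal, sgn]
  rw [h]
  exact ((hX.bracket (hφ.smul (he.smooth 0))).sub (hφ.smul (hX.bracket (he.smooth 0)))).inner
    (he.smooth 0)

/-- The Lie bracket acts on functions as the commutator; this is the Jacobi identity for
`X`, `Y` and `φ • e₀`. -/
lemma IsOrthonormalFrame.along_bracket (he : IsOrthonormalFrame g e) {X Y : VField M} {φ : M → ℝ}
    (hX : SmoothVField X) (hY : SmoothVField Y) (hφ : SmoothFn φ) (x : M) :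
    along (mlieBracket (𝓡 4) X Y) φ x = along X (along Y φ) x - along Y (along X φ) x := by
  have h0 := he.smooth 0
  have key := jacobi_mlieBracket hX hY (hφ.smul h0) x
  have expand : ∀ {U W : VField M}, SmoothVField U → SmoothVField W →
      mlieBracket (𝓡 4) U (mlieBracket (𝓡 4) W (fun y ↦ φ y • e 0 y)) x
        = (along U (along W φ) x • e 0 x + along W φ x • mlieBracket (𝓡 4) U (e 0) x)
          + (along U φ x • mlieBracket (𝓡 4) W (e 0) x
            + φ x • mlieBracket (𝓡 4) U (mlieBracket (𝓡 4) W (e 0)) x) := by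
    intro U W hU hW
    have : mlieBracket (𝓡 4) W (fun y ↦ φ y • e 0 y)
        = fun y ↦ along W φ y • e 0 y + φ y • mlieBracket (𝓡 4) W (e 0) y :=
      funext fun y ↦ bracket_smul hφ h0 y
    rw [this, bracket_add ((he.smooth_along hW hφ).smul h0) (hφ.smul (hW.bracket h0)),
      bracket_smul (he.smooth_along hW hφ) h0, bracket_smul hφ (hW.bracket h0)]
  -- The mixed terms `(X φ) [Y, e₀]` and `(Y φ) [X, e₀]` occur on both sides, and the terms carrying
  -- `φ` cancel by Jacobi for `X`, `Y`, `e₀`. Only multiples of `e₀` remain.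
  rw [expand hX hY, expand hY hX, bracket_smul hφ h0, jacobi_mlieBracket hX hY h0 x] at key
  have key2 : along (mlieBracket (𝓡 4) X Y) φ x • e 0 x
      = (along X (along Y φ) x - along Y (along X φ) x) • e 0 x := by
    rw [sub_smul, eq_sub_iff_add_eq]
    rw [← sub_eq_zero] at key ⊢
    rw [← neg_eq_zero, ← key]
    module
  have h1 := congrArg (fun v ↦ g.val x v (e 0 x)) key2
  simpa [he.orthonormal, sgn] using h1

/-! ### The divergence -/

/-- The divergence `∇_a X^a`, with the trace taken in the frame `e`. -/
noncomputable def divergence (g : LorentzMetric M) (cov : Connection M) (e : Fin 4 → VField M)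
    (X : VField M) : M → ℝ := fun x ↦ ∑ i, sgn i * g.val x (cov X x (e i x)) (e i x)

lemma smooth_divergence (h : IsLeviCivita g cov) (he : IsOrthonormalFrame g e) {X : VField M}
    (hX : SmoothVField X) : SmoothFn (divergence g cov e X) :=
  SmoothFn.sum fun i ↦ (smoothFn_const _).mul (((he.smooth i).cov h hX).inner (he.smooth i))

lemma divergence_smul (cov : Connection M) (he : IsOrthonormalFrame g e) {X : VField M}
    {φ : M → ℝ} (hφ : SmoothFn φ) (hX : SmoothVField X) (x : M) :
    divergence g cov e (fun y ↦ φ y • X y) x = along X φ x + φ x * divergence g cov e X x := by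
  have h1 : along X φ x = ∑ i, sgn i * g.val x (X x) (e i x) * mvfderiv (𝓡 4) φ x (e i x) :=
    he.inner_eq_sum (mvfderiv (𝓡 4) φ x) (X x)
  rw [h1, divergence, divergence, Finset.mul_sum, ← Finset.sum_add_distrib]
  refine Finset.sum_congr rfl fun i _ ↦ ?_
  rw [cov_smul cov hφ hX]
  simp only [map_add, map_smul, add_apply, smul_apply, smul_eq_mul]
  ring

lemma divergence_add (cov : Connection M) {X Y : VField M} (hX : SmoothVField X)
    (hY : SmoothVField Y) (x : M) :
    divergence g cov e (fun y ↦ X y + Y y) x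
      = divergence g cov e X x + divergence g cov e Y x := by
  simp only [divergence, cov_add cov hX hY, ← Finset.sum_add_distrib]
  refine Finset.sum_congr rfl fun i _ ↦ ?_
  simp only [map_add, add_apply]
  ring

lemma divergence_sum (cov : Connection M) {ι : Type*} {s : Finset ι} {X : ι → VField M}
    (hX : ∀ i, SmoothVField (X i)) (x : M) :
    divergence g cov e (fun y ↦ ∑ i ∈ s, X i y) x = ∑ i ∈ s, divergence g cov e (X i) x := by
  simp only [divergence, cov_sum cov hX]
  rw [Finset.sum_comm]
  refine Finset.sum_congr rfl fun i _ ↦ ?_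
  simp only [map_sum, sum_apply, Finset.mul_sum]

/-- The connection coefficients of an orthonormal frame are skew in the last two indices. -/
lemma connection_skew (h : IsLeviCivita g cov) (he : IsOrthonormalFrame g e) (x : M)
    (v : TangentSpace (𝓡 4) x) (i j : Fin 4) :
    g.val x (cov (e i) x v) (e j x) = -g.val x (cov (e j) x v) (e i x) := by
  have h1 := h.metric (e i) (e j) x ((he.smooth i).diffAt x) ((he.smooth j).diffAt x) v
  simp only [he.orthonormal] at h1
  rw [mvfderiv_const, g.symm x (e i x)] at h1
  have h2 : (0 : ℝ) = _ := h1
  linarith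

/-- The bracket differs from `∇_{eᵢ} X` by `∇_X eᵢ`, which is orthogonal to `eᵢ` because `g(eᵢ, eᵢ)`
is constant. -/
lemma divergence_eq_bracket (h : IsLeviCivita g cov) (he : IsOrthonormalFrame g e) {X : VField M}
    (hX : SmoothVField X) (x : M) :
    divergence g cov e X x = ∑ i, sgn i * g.val x (mlieBracket (𝓡 4) (e i) X x) (e i x) := by
  refine Finset.sum_congr rfl fun i _ ↦ ?_
  rw [h.bracket_eq (he.smooth i) hX]
  have := connection_skew h he x (X x) i i
  simp only [map_sub, sub_apply]
  rw [show g.val x (cov (e i) x (X x)) (e i x) = 0 by linarith, sub_zero]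

/-- `div [X, Y] = X (div Y) - Y (div X)`. -/
lemma divergence_bracket (h : IsLeviCivita g cov) (he : IsOrthonormalFrame g e) {X Y : VField M}
    (hX : SmoothVField X) (hY : SmoothVField Y) (x : M) :
    divergence g cov e (mlieBracket (𝓡 4) X Y) x
      = along X (divergence g cov e Y) x - along Y (divergence g cov e X) x := by
  -- the matrix of `ad Z` in the frame
  let ad : VField M → Fin 4 → Fin 4 → M → ℝ := fun Z i k y ↦
    sgn k * g.val y (mlieBracket (𝓡 4) (e i) Z y) (e k y)
  have had : ∀ {Z : VField M}, SmoothVField Z → ∀ i k, SmoothFn (ad Z i k) := fun hZ i k ↦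
    (smoothFn_const _).mul (((he.smooth i).bracket hZ).inner (he.smooth k))
  have hdiv : ∀ {Z : VField M}, SmoothVField Z → divergence g cov e Z = fun y ↦ ∑ i, ad Z i i y :=
    fun hZ ↦ funext fun y ↦ divergence_eq_bracket h he hZ y
  have hexp : ∀ (Z : VField M) (i : Fin 4),
      mlieBracket (𝓡 4) (e i) Z = fun y ↦ ∑ k, ad Z i k y • e k y :=
    fun Z i ↦ funext fun y ↦ he.expand y _
  -- The correction is `tr (ad W ad U)`, symmetric in `U` and `W`, so it drops out of the difference
  -- formed below.
  have trace : ∀ {U W : VField M}, SmoothVField U → SmoothVField W →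
      ∑ i, sgn i * g.val x (mlieBracket (𝓡 4) U (mlieBracket (𝓡 4) (e i) W) x) (e i x)
        = along U (divergence g cov e W) x - ∑ i, ∑ k, ad W i k x * ad U k i x := by
    intro U W hU hW
    rw [hdiv hW, along_sum fun i ↦ had hW i i, ← Finset.sum_sub_distrib]
    refine Finset.sum_congr rfl fun i _ ↦ ?_
    have h1 : mlieBracket (𝓡 4) U (mlieBracket (𝓡 4) (e i) W) x
        = ∑ k, along U (ad W i k) x • e k x
          - ∑ k, ad W i k x • mlieBracket (𝓡 4) (e k) U x := by
      rw [hexp W i, bracket_sum fun k ↦ (had hW i k).smul (he.smooth k),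
        ← Finset.sum_sub_distrib]
      refine Finset.sum_congr rfl fun k _ ↦ ?_
      rw [bracket_smul (had hW i k) (he.smooth k), bracket_swap U (e k), smul_neg, sub_eq_add_neg]
    rw [h1, map_sub, sub_apply, he.inner_sum, mul_sub, ← mul_assoc, sgn_mul_self, one_mul]
    congr 1
    simp only [map_sum, map_smul, sum_apply, smul_apply, Finset.mul_sum,
      smul_eq_mul]
    exact Finset.sum_congr rfl fun k _ ↦ by simp only [ad]; ring
  rw [divergence_eq_bracket h he (hX.bracket hY)]
  have hsplit : ∀ i, sgn i * g.val x (mlieBracket (𝓡 4) (e i) (mlieBracket (𝓡 4) X Y) x) (e i x)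
      = sgn i * g.val x (mlieBracket (𝓡 4) X (mlieBracket (𝓡 4) (e i) Y) x) (e i x)
        - sgn i * g.val x (mlieBracket (𝓡 4) Y (mlieBracket (𝓡 4) (e i) X) x) (e i x) := by
    intro i
    rw [jacobi_mlieBracket (he.smooth i) hX hY, bracket_swap (mlieBracket (𝓡 4) (e i) X) Y]
    simp only [map_add, map_neg, add_apply, neg_apply]
    ring
  simp only [hsplit, Finset.sum_sub_distrib]
  rw [trace hX hY, trace hY hX, Finset.sum_comm]
  have : ∑ k, ∑ i, ad Y i k x * ad X k i x = ∑ i, ∑ k, ad X i k x * ad Y k i x :=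
    Finset.sum_congr rfl fun _ _ ↦ Finset.sum_congr rfl fun _ _ ↦ mul_comm _ _
  rw [this]; ring

end Frame

section Proca

variable {g : LorentzMetric M} {cov : Connection M} {e : Fin 4 → VField M}

/-! ### The divergence of a bivector -/

/-- The divergence `∇_a H^{ab}` of the bivector `∑ H i j eᵢ ⊗ eⱼ`, written with Lie brackets. -/
noncomputable def skewDivergence (g : LorentzMetric M) (cov : Connection M) (e : Fin 4 → VField M)
    (H : Fin 4 → Fin 4 → M → ℝ) : VField M := fun y ↦
  ∑ i, ∑ j, ((along (e i) (H i j) y + divergence g cov e (e i) y * H i j y) • e j y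
    + (2⁻¹ * H i j y) • mlieBracket (𝓡 4) (e i) (e j) y)

/-- `∇_b ∇_a H^{ab} = 0` for skew `H`. -/
lemma divergence_skewDivergence (h : IsLeviCivita g cov) (he : IsOrthonormalFrame g e)
    {H : Fin 4 → Fin 4 → M → ℝ} (hH : ∀ i j, SmoothFn (H i j))
    (hskew : ∀ i j y, H j i y = -H i j y) (x : M) :
    divergence g cov e (skewDivergence g cov e H) x = 0 := by
  have hd : ∀ i, SmoothFn (divergence g cov e (e i)) := fun i ↦ smooth_divergence h he (he.smooth i)
  have ha : ∀ i j, SmoothFn (along (e i) (H i j)) := fun i j ↦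
    he.smooth_along (he.smooth i) (hH i j)
  have hc : ∀ i j, SmoothFn (fun y ↦
      along (e i) (H i j) y + divergence g cov e (e i) y * H i j y) :=
    fun i j ↦ (ha i j).add ((hd i).mul (hH i j))
  have hc' : ∀ i j, SmoothFn (fun y ↦ 2⁻¹ * H i j y) := fun i j ↦ (smoothFn_const _).mul (hH i j)
  have hb : ∀ i j, SmoothVField (mlieBracket (𝓡 4) (e i) (e j)) := fun i j ↦
    (he.smooth i).bracket (he.smooth j)
  have hs : ∀ i j, SmoothVField (fun y ↦
      (along (e i) (H i j) y + divergence g cov e (e i) y * H i j y) • e j y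
        + (2⁻¹ * H i j y) • mlieBracket (𝓡 4) (e i) (e j) y) := fun i j ↦
    ((hc i j).smul (he.smooth j)).add ((hc' i j).smul (hb i j))
  unfold skewDivergence
  rw [divergence_sum cov fun i ↦ SmoothVField.sum fun j ↦ hs i j]
  simp only [fun i ↦ divergence_sum (g := g) (e := e) (s := Finset.univ) cov (fun j ↦ hs i j) x]
  let T : Fin 4 → Fin 4 → ℝ := fun i j ↦ divergence g cov e (fun y ↦
      (along (e i) (H i j) y + divergence g cov e (e i) y * H i j y) • e j y
        + (2⁻¹ * H i j y) • mlieBracket (𝓡 4) (e i) (e j) y) x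
  -- The term `½ H [eᵢ, eⱼ]` symmetrises `eⱼ eᵢ H` and `eⱼ (div eᵢ)`: what acts on `H i j` becomes
  -- symmetric in `i` and `j`. Skewness of `H` then makes `T` skew, and its double sum vanishes.
  have hT : ∀ i j, T i j
      = 2⁻¹ * (along (e i) (along (e j) (H i j)) x + along (e j) (along (e i) (H i j)) x)
        + 2⁻¹ * H i j x * (along (e i) (divergence g cov e (e j)) x
          + along (e j) (divergence g cov e (e i)) x)
        + divergence g cov e (e i) x * along (e j) (H i j) x
        + divergence g cov e (e j) x * along (e i) (H i j) x
        + divergence g cov e (e i) x * divergence g cov e (e j) x * H i j x := by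
    intro i j
    simp only [T]
    rw [divergence_add cov ((hc i j).smul (he.smooth j)) ((hc' i j).smul (hb i j)),
      divergence_smul cov he (hc i j) (he.smooth j), divergence_smul cov he (hc' i j) (hb i j),
      along_add (ha i j) ((hd i).mul (hH i j)), along_mul (hd i) (hH i j),
      along_const_mul (hH i j), he.along_bracket (he.smooth i) (he.smooth j) (hH i j),
      divergence_bracket h he (he.smooth i) (he.smooth j)]
    ring
  have hTskew : ∀ i j, T j i = -T i j := by
    intro i j
    have hn : H j i = fun y ↦ -H i j y := funext (hskew i j)
    have hn' : ∀ k, along (e k) (H j i) = fun y ↦ -along (e k) (H i j) y := fun k ↦ by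
      rw [hn]; exact funext fun y ↦ along_neg (hH i j) y
    rw [hT, hT, hn', hn', along_neg (ha i j), along_neg (he.smooth_along (he.smooth j) (hH i j)),
      hskew i j]
    ring
  have hsum : ∑ i, ∑ j, T i j = -∑ i, ∑ j, T i j := by
    conv_lhs => rw [Finset.sum_comm]
    simp only [← Finset.sum_neg_distrib]
    exact Finset.sum_congr rfl fun i _ ↦ Finset.sum_congr rfl fun j _ ↦ hTskew i j
  have : ∑ i, ∑ j, T i j = 0 := by linarith
  exact this

lemma bivector_skew (cov : Connection M) (A : VField M) (x : M) (v w : TangentSpace (𝓡 4) x) :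
    bivector g cov A x w v = -bivector g cov A x v w := by
  simp only [bivector]; ring

lemma bivector_expand_right (he : IsOrthonormalFrame g e) (cov : Connection M) (A : VField M)
    (x : M) (v w : TangentSpace (𝓡 4) x) :
    bivector g cov A x v w = ∑ j, sgn j * g.val x w (e j x) * bivector g cov A x v (e j x) := by
  have h := he.inner_eq_sum (g.val x (cov A x v) - (g.val x v).comp (cov A x)) w
  simp only [bivector, g.symm x _ v]
  exact h

lemma bivector_expand_left (he : IsOrthonormalFrame g e) (cov : Connection M) (A : VField M)
    (x : M) (v w : TangentSpace (𝓡 4) x) :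
    bivector g cov A x v w = ∑ j, sgn j * g.val x v (e j x) * bivector g cov A x (e j x) w := by
  rw [bivector_skew, bivector_expand_right he, ← Finset.sum_neg_distrib]
  exact Finset.sum_congr rfl fun j _ ↦ by rw [bivector_skew cov A x w]; ring

lemma smooth_bivector (h : IsLeviCivita g cov) {A X Y : VField M} (hA : SmoothVField A)
    (hX : SmoothVField X) (hY : SmoothVField Y) :
    SmoothFn (fun y ↦ bivector g cov A y (X y) (Y y)) :=
  ((hX.cov h hA).inner hY).sub ((hY.cov h hA).inner hX)

/-- Links the bracket form of the divergence to the covariant one in the Proca equation. The signs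
raise both indices of `f`. -/
lemma skewDivergence_bivector (h : IsLeviCivita g cov) (he : IsOrthonormalFrame g e)
    {A : VField M} (hA : SmoothVField A) (x : M) (k : Fin 4) :
    g.val x (skewDivergence g cov e
        (fun i j y ↦ sgn i * sgn j * bivector g cov A y (e i y) (e j y)) x) (e k x)
      = ∑ i, sgn i * covBivector g cov A (e i) (e i) (e k) x := by
  have hf : ∀ i j, SmoothFn (fun y ↦ bivector g cov A y (e i y) (e j y)) := fun i j ↦
    smooth_bivector h hA (he.smooth i) (he.smooth j)
  let f : Fin 4 → Fin 4 → ℝ := fun i j ↦ bivector g cov A x (e i x) (e j x)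
  let Γ : Fin 4 → Fin 4 → Fin 4 → ℝ := fun i j l ↦ g.val x (cov (e j) x (e i x)) (e l x)
  have hfskew : ∀ i j, f j i = -f i j := fun i j ↦ bivector_skew cov A x _ _
  have hΓ : ∀ i j l, Γ i j l = -Γ i l j := fun i j l ↦ connection_skew h he x _ j l
  have hL : g.val x (skewDivergence g cov e
        (fun i j y ↦ sgn i * sgn j * bivector g cov A y (e i y) (e j y)) x) (e k x)
      = ∑ i, sgn i * along (e i) (fun y ↦ bivector g cov A y (e i y) (e k y)) x
        + ∑ i, sgn i * (∑ l, sgn l * Γ l i l) * f i k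
        + ∑ i, ∑ j, 2⁻¹ * (sgn i * sgn j * f i j) * (Γ i j k - Γ j i k) := by
    simp only [skewDivergence, map_sum, sum_apply]
    rw [← Finset.sum_add_distrib, ← Finset.sum_add_distrib]
    refine Finset.sum_congr rfl fun i _ ↦ ?_
    simp only [map_add, map_smul, add_apply, smul_apply, smul_eq_mul, Finset.sum_add_distrib,
      he.orthonormal, mul_ite, mul_zero, Finset.sum_ite_eq', Finset.mem_univ, if_true]
    rw [along_const_mul (hf i k)]
    congr 1
    · simp only [divergence, f, Γ]
      linear_combination (sgn i * along (e i) (fun y ↦ bivector g cov A y (e i y) (e k y)) x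
        + sgn i * (∑ l, sgn l * g.val x (cov (e i) x (e l x)) (e l x))
          * bivector g cov A x (e i x) (e k x)) * sgn_mul_self k
    · refine Finset.sum_congr rfl fun j _ ↦ ?_
      rw [h.bracket_eq (he.smooth i) (he.smooth j)]
      simp only [map_sub, sub_apply, f, Γ]
  have hR : ∑ i, sgn i * covBivector g cov A (e i) (e i) (e k) x
      = ∑ i, sgn i * along (e i) (fun y ↦ bivector g cov A y (e i y) (e k y)) x
        - ∑ i, sgn i * (∑ j, sgn j * Γ i i j * f j k)
        - ∑ i, sgn i * (∑ j, sgn j * Γ i k j * f i j) := by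
    rw [← Finset.sum_sub_distrib, ← Finset.sum_sub_distrib]
    refine Finset.sum_congr rfl fun i _ ↦ ?_
    simp only [covBivector]
    rw [bivector_expand_left he cov A x (cov (e i) x (e i x)),
      bivector_expand_right he cov A x _ (cov (e k) x (e i x))]
    simp only [along, f, Γ]
    ring
  -- By skewness of `Γ`, the terms with `div eᵢ` are those with `∇_{eᵢ} eᵢ`.
  have h1 : ∑ i, sgn i * (∑ l, sgn l * Γ l i l) * f i k
      = -∑ i, sgn i * (∑ j, sgn j * Γ i i j * f j k) := by
    simp only [Finset.mul_sum, Finset.sum_mul]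
    rw [Finset.sum_comm, ← Finset.sum_neg_distrib]
    refine Finset.sum_congr rfl fun i _ ↦ ?_
    rw [← Finset.sum_neg_distrib]
    refine Finset.sum_congr rfl fun j _ ↦ ?_
    rw [hΓ i i j]; ring
  -- Since `f` is skew, the two halves of the torsion-free bracket contribute equally, which absorbs
  -- the factor `½`.
  have h2 : ∑ i, ∑ j, 2⁻¹ * (sgn i * sgn j * f i j) * (Γ i j k - Γ j i k)
      = -∑ i, sgn i * (∑ j, sgn j * Γ i k j * f i j) := by
    have h3 : ∑ i, ∑ j, 2⁻¹ * (sgn i * sgn j * f i j) * Γ j i k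
        = -∑ i, ∑ j, 2⁻¹ * (sgn i * sgn j * f i j) * Γ i j k := by
      rw [Finset.sum_comm]
      simp only [← Finset.sum_neg_distrib]
      refine Finset.sum_congr rfl fun i _ ↦ Finset.sum_congr rfl fun j _ ↦ ?_
      rw [hfskew i j]; ring
    simp only [mul_sub, Finset.sum_sub_distrib]
    rw [h3]
    simp only [Finset.mul_sum, ← Finset.sum_neg_distrib, ← Finset.sum_sub_distrib]
    refine Finset.sum_congr rfl fun i _ ↦ Finset.sum_congr rfl fun j _ ↦ ?_
    rw [hΓ i k j]; ring
  rw [hL, hR, h1, h2]; ring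

/-- A massive Proca field is divergence free. -/
lemma IsProcaField.divergence_eq_zero (h : IsLeviCivita g cov) (he : IsOrthonormalFrame g e)
    {mass : ℝ} (hmass : mass ≠ 0) {A : VField M} (hA : SmoothVField A)
    (hP : IsProcaField g cov e mass A) (x : M) : divergence g cov e A x = 0 := by
  let H : Fin 4 → Fin 4 → M → ℝ := fun i j y ↦
    sgn i * sgn j * bivector g cov A y (e i y) (e j y)
  have hH : ∀ i j, SmoothFn (H i j) := fun i j ↦
    (smoothFn_const _).mul (smooth_bivector h hA (he.smooth i) (he.smooth j))
  -- This is the Proca equation tested on the frame fields. The left side is divergence free, so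
  -- `mass ^ 2` times `div A` vanishes.
  have hJ : skewDivergence g cov e H = fun y ↦ (-mass ^ 2) • A y := by
    funext y
    rw [he.expand y (skewDivergence g cov e H y), he.expand y ((-mass ^ 2) • A y)]
    refine Finset.sum_congr rfl fun k _ ↦ ?_
    have h1 := hP (e k) (he.smooth k) y
    rw [← skewDivergence_bivector h he hA] at h1
    congr 2
    simp only [map_smul, smul_apply, smul_eq_mul]
    linarith
  have h0 := divergence_skewDivergence h he hH
    (fun i j y ↦ by simp only [H]; rw [bivector_skew]; ring) x
  rw [hJ, divergence_smul cov he (smoothFn_const _) hA, along_const, zero_add] at h0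
  exact (mul_eq_zero.1 h0).resolve_left (neg_ne_zero.2 (pow_ne_zero 2 hmass))

/-! ### Contraction with a parallel vector field -/

lemma IsParallel.along_inner (h : IsLeviCivita g cov) {Y A : VField M} (hY : SmoothVField Y)
    (hpar : IsParallel cov Y) (hA : SmoothVField A) (Z : VField M) (x : M) :
    along Z (fun y ↦ g.val y (Y y) (A y)) x = g.val x (Y x) (cov A x (Z x)) := by
  rw [h.along_inner hY hA, hpar x]; simp

/-- Skewness of the connection coefficients gives `∑ sgn(i) ∇_{eᵢ} eᵢ = -∑ sgn(i) (div eᵢ) eᵢ`. -/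
lemma sum_along_cov_frame (h : IsLeviCivita g cov) (he : IsOrthonormalFrame g e) (φ : M → ℝ)
    (x : M) : ∑ i, sgn i * mvfderiv (𝓡 4) φ x (cov (e i) x (e i x))
      = -∑ i, sgn i * divergence g cov e (e i) x * along (e i) φ x := by
  simp only [divergence, Finset.mul_sum, Finset.sum_mul]
  rw [Finset.sum_comm (γ := Fin 4), ← Finset.sum_neg_distrib]
  refine Finset.sum_congr rfl fun i _ ↦ ?_
  rw [he.inner_eq_sum (mvfderiv (𝓡 4) φ x) (cov (e i) x (e i x)), Finset.mul_sum,
    ← Finset.sum_neg_distrib]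
  refine Finset.sum_congr rfl fun j _ ↦ ?_
  rw [connection_skew h he x _ i j]
  simp only [along]
  ring

/-- The scalar d'Alembertian `∑ sgn(i) (eᵢ eᵢ φ + (div eᵢ) eᵢ φ)`. -/
noncomputable def scalarWave (g : LorentzMetric M) (cov : Connection M) (e : Fin 4 → VField M)
    (φ : M → ℝ) (x : M) : ℝ :=
  ∑ i, sgn i * along (e i) (along (e i) φ) x
    + ∑ i, sgn i * divergence g cov e (e i) x * along (e i) φ x

/-- The d'Alembertian commutes with contraction by a parallel field. -/
lemma inner_waveOp (h : IsLeviCivita g cov) (he : IsOrthonormalFrame g e) {Y A : VField M}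
    (hY : SmoothVField Y) (hpar : IsParallel cov Y) (hA : SmoothVField A) (x : M) :
    g.val x (Y x) (waveOp cov e A x) = scalarWave g cov e (fun y ↦ g.val y (Y y) (A y)) x := by
  have h1 : ∀ Z, along Z (fun y ↦ g.val y (Y y) (A y)) = fun y ↦ g.val y (Y y) (cov A y (Z y)) :=
    fun Z ↦ funext fun y ↦ hpar.along_inner h hY hA Z y
  have h2 : ∀ v, mvfderiv (𝓡 4) (fun y ↦ g.val y (Y y) (A y)) x v
      = g.val x (Y x) (cov A x v) := by
    intro v
    rw [h.metric Y A x (hY.diffAt x) (hA.diffAt x), hpar x]; simp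
  rw [scalarWave, ← sub_neg_eq_add, ← sum_along_cov_frame h he, ← Finset.sum_sub_distrib]
  simp only [waveOp, map_sum]
  refine Finset.sum_congr rfl fun i _ ↦ ?_
  rw [h1, hpar.along_inner h hY ((he.smooth i).cov h hA), h2]
  simp only [map_smul, map_sub, smul_eq_mul]
  ring

lemma IsProcaField.inner_waveOp_eq_zero (h : IsLeviCivita g cov) (he : IsOrthonormalFrame g e)
    {mass : ℝ} (hmass : mass ≠ 0) {Y A : VField M} (hA : SmoothVField A)
    (hP : IsProcaField g cov e mass A) (hY : SmoothVField Y) (hpar : IsParallel cov Y) (x : M) :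
    g.val x (Y x) (waveOp cov e A x + mass ^ 2 • A x) = 0 := by
  have hYA := hY.cov h hA
  have hbr : (fun y ↦ cov A y (Y y)) = mlieBracket (𝓡 4) Y A := by
    funext y; rw [h.bracket_eq hY hA, hpar y]; simp
  have hdivA : divergence g cov e A = fun _ ↦ 0 :=
    funext fun y ↦ hP.divergence_eq_zero h he hmass hA y
  have hdivY : divergence g cov e Y = fun _ ↦ 0 := by
    funext y; simp [divergence, hpar y]
  have hdiv : divergence g cov e (fun y ↦ cov A y (Y y)) x = 0 := by
    rw [hbr, divergence_bracket h he hY hA, hdivA, hdivY, along_const, along_const, sub_zero]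
  -- In `(∇_{eᵢ} f)(eᵢ, Y)` the two occurrences of `g(∇_Y A, ∇_{eᵢ} eᵢ)` cancel, and the terms with
  -- `∇Y` vanish.
  have key : ∑ i, sgn i * covBivector g cov A (e i) (e i) Y x
      = g.val x (Y x) (waveOp cov e A x) - divergence g cov e (fun y ↦ cov A y (Y y)) x := by
    simp only [waveOp, map_sum, divergence]
    rw [← Finset.sum_sub_distrib]
    refine Finset.sum_congr rfl fun i _ ↦ ?_
    have hiA := (he.smooth i).cov h hA
    have h1 := along_sub (X := e i) (hiA.inner (g := g) hY) (hYA.inner (g := g) (he.smooth i)) x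
    rw [h.along_inner hiA hY, h.along_inner hYA (he.smooth i), hpar x] at h1
    have h2 : covBivector g cov A (e i) (e i) Y x
      = along (e i) (fun y ↦ g.val y (cov A y (e i y)) (Y y) - g.val y (cov A y (Y y)) (e i y)) x
        - bivector g cov A x (cov (e i) x (e i x)) (Y x)
        - bivector g cov A x (e i x) (cov Y x (e i x)) := rfl
    rw [h2, h1, hpar x]
    simp only [bivector, map_smul, map_sub, smul_apply, sub_apply, smul_eq_mul, zero_apply, map_zero,
      add_zero, g.symm x (Y x)]
    ring
  have h3 := hP Y hY x
  rw [key, hdiv, g.symm x (A x)] at h3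
  simp only [map_add, map_smul, smul_eq_mul]
  linarith

end Proca

section NewmanPenrose

variable {g : LorentzMetric M} {cov : Connection M} {e : Fin 4 → VField M}

/-! ### Derivatives along the null tetrad -/

lemma mvfderiv_clm_comp {φ : M → ℝ} (hφ : SmoothFn φ) (L : ℝ →L[ℝ] ℂ) (x : M)
    (w : TangentSpace (𝓡 4) x) :
    mvfderiv (𝓡 4) (fun y ↦ L (φ y)) x w = L (mvfderiv (𝓡 4) φ x w) := by
  have h1 := (L.hasFDerivAt (x := φ x)).hasMFDerivAt.comp x (hφ.diffAt x).hasMFDerivAt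
  have h2 : mfderiv (𝓡 4) 𝓘(ℝ, ℂ) (fun y ↦ L (φ y)) x = _ := h1.mfderiv
  simp only [mvfderiv]
  rw [h2]
  rfl

lemma mvfderiv_ofReal_add_I_mul {u v : M → ℝ} (hu : SmoothFn u) (hv : SmoothFn v) (x : M)
    (w : TangentSpace (𝓡 4) x) :
    mvfderiv (𝓡 4) (fun y ↦ (u y : ℂ) + Complex.I * v y) x w
      = (mvfderiv (𝓡 4) u x w : ℝ) + Complex.I * (mvfderiv (𝓡 4) v x w : ℝ) := by
  have hL : ∀ {φ : M → ℝ}, SmoothFn φ → ∀ L : ℝ →L[ℝ] ℂ,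
      MDifferentiableAt (𝓡 4) 𝓘(ℝ, ℂ) (fun y ↦ L (φ y)) x := fun hφ L ↦
    L.differentiableAt.comp_mdifferentiableAt (hφ.diffAt x)
  have h1 := mvfderiv_fun_add (hL hu Complex.ofRealCLM) (hL hv (Complex.I • Complex.ofRealCLM))
  have h2 := DFunLike.congr_fun h1 w
  rw [add_apply, mvfderiv_clm_comp hu, mvfderiv_clm_comp hv] at h2
  exact h2

lemma dirDeriv_ofReal {φ : M → ℝ} (hφ : SmoothFn φ) (Z : CField M) :
    dirDeriv Z (fun y ↦ (φ y : ℂ))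
      = fun y ↦ (along Z.re φ y : ℂ) + Complex.I * (along Z.im φ y : ℂ) := by
  funext x
  have h := fun w ↦ mvfderiv_clm_comp hφ Complex.ofRealCLM x w
  simp only [Complex.ofRealCLM_apply] at h
  simp only [dirDeriv, h, along]

lemma dirDeriv_ofReal_add_I_mul {u v : M → ℝ} (hu : SmoothFn u) (hv : SmoothFn v) (Z : CField M)
    (x : M) : dirDeriv Z (fun y ↦ (u y : ℂ) + Complex.I * v y) x
      = ⟨along Z.re u x - along Z.im v x, along Z.re v x + along Z.im u x⟩ := by
  simp only [dirDeriv, mvfderiv_ofReal_add_I_mul hu hv, along]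
  apply Complex.ext <;> simp [sub_eq_add_neg]

lemma along_zero (φ : M → ℝ) (x : M) : along (fun _ ↦ 0) φ x = 0 := by
  simp only [along]; exact map_zero _

lemma along_tetL (φ : M → ℝ) (x : M) :
    along (tetL e) φ x = (√2)⁻¹ * (along (e 0) φ x + along (e 3) φ x) := by
  simp [along, tetL, mul_add]

lemma along_tetN (φ : M → ℝ) (x : M) :
    along (tetN e) φ x = (√2)⁻¹ * (along (e 0) φ x - along (e 3) φ x) := by
  simp [along, tetN]

lemma along_tetM_re (φ : M → ℝ) (x : M) :
    along (tetM e).re φ x = (√2)⁻¹ * along (e 1) φ x := by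
  simp [along, tetM]

lemma along_tetM_im (φ : M → ℝ) (x : M) :
    along (tetM e).im φ x = -((√2)⁻¹ * along (e 2) φ x) := by
  simp [along, tetM]

lemma along_tetMbar_re (φ : M → ℝ) (x : M) :
    along (tetMbar e).re φ x = (√2)⁻¹ * along (e 1) φ x := along_tetM_re φ x

lemma along_tetMbar_im (φ : M → ℝ) (x : M) :
    along (tetMbar e).im φ x = (√2)⁻¹ * along (e 2) φ x := by
  simp [along, tetM, tetMbar, CField.conj]

lemma sqrt_two_inv_sq : (√2)⁻¹ ^ 2 = (2⁻¹ : ℝ) := by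
  rw [inv_pow, Real.sq_sqrt (by norm_num)]

section FirstOrder

variable {φ : M → ℝ}

/-- The zero imaginary part is kept so that the result has the form `u + i v` to which
`dirDeriv_ofReal_add_I_mul` applies for the second derivative. -/
lemma opD_ofReal (hφ : SmoothFn φ) : opD e (fun y ↦ (φ y : ℂ))
    = fun y ↦ (((√2)⁻¹ * (along (e 0) φ y + along (e 3) φ y) : ℝ) : ℂ)
      + Complex.I * ((0 : ℝ) : ℂ) := by
  rw [opD, dirDeriv_ofReal hφ]
  funext y
  simp only [cL, CField.ofReal, along_tetL, along_zero]

lemma opDelta_ofReal (hφ : SmoothFn φ) : opDelta e (fun y ↦ (φ y : ℂ))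
    = fun y ↦ (((√2)⁻¹ * (along (e 0) φ y - along (e 3) φ y) : ℝ) : ℂ)
      + Complex.I * ((0 : ℝ) : ℂ) := by
  rw [opDelta, dirDeriv_ofReal hφ]
  funext y
  simp only [cN, CField.ofReal, along_tetN, along_zero]

lemma opdelta_ofReal (hφ : SmoothFn φ) : opdelta e (fun y ↦ (φ y : ℂ))
    = fun y ↦ (((√2)⁻¹ * along (e 1) φ y : ℝ) : ℂ)
      + Complex.I * ((-(√2)⁻¹ * along (e 2) φ y : ℝ) : ℂ) := by
  rw [opdelta, dirDeriv_ofReal hφ]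
  funext y
  simp only [along_tetM_re, along_tetM_im, neg_mul]

lemma opdeltaBar_ofReal (hφ : SmoothFn φ) : opdeltaBar e (fun y ↦ (φ y : ℂ))
    = fun y ↦ (((√2)⁻¹ * along (e 1) φ y : ℝ) : ℂ)
      + Complex.I * (((√2)⁻¹ * along (e 2) φ y : ℝ) : ℂ) := by
  rw [opdeltaBar, dirDeriv_ofReal hφ]
  funext y
  simp only [along_tetMbar_re, along_tetMbar_im]

/-- The second-order part `DΔ + ΔD - δδ̄ - δ̄δ` is `∑ sgn(i) eᵢ eᵢ`. -/
lemma second_order_part (he : IsOrthonormalFrame g e) (hφ : SmoothFn φ) (x : M) :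
    opD e (opDelta e (fun y ↦ (φ y : ℂ))) x + opDelta e (opD e (fun y ↦ (φ y : ℂ))) x
      - opdelta e (opdeltaBar e (fun y ↦ (φ y : ℂ))) x
      - opdeltaBar e (opdelta e (fun y ↦ (φ y : ℂ))) x
    = ((∑ i, sgn i * along (e i) (along (e i) φ) x : ℝ) : ℂ) := by
  have hs : ∀ i, SmoothFn (along (e i) φ) := fun i ↦ he.smooth_along (he.smooth i) hφ
  have h0 := smoothFn_const (M := M) 0
  have hc : ∀ (c : ℝ) {ψ : M → ℝ}, SmoothFn ψ → SmoothFn (fun y ↦ c * ψ y) :=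
    fun c _ hψ ↦ (smoothFn_const c).mul hψ
  rw [opD_ofReal hφ, opDelta_ofReal hφ, opdelta_ofReal hφ, opdeltaBar_ofReal hφ, opD, opDelta,
    opdelta, opdeltaBar, dirDeriv_ofReal_add_I_mul (hc _ ((hs 0).sub (hs 3))) h0,
    dirDeriv_ofReal_add_I_mul (hc _ ((hs 0).add (hs 3))) h0,
    dirDeriv_ofReal_add_I_mul (hc _ (hs 1)) (hc _ (hs 2)),
    dirDeriv_ofReal_add_I_mul (hc _ (hs 1)) (hc _ (hs 2))]
  simp only [cL, cN, CField.ofReal, along_tetL, along_tetN, along_tetM_re, along_tetM_im,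
    along_tetMbar_re, along_tetMbar_im, along_zero, along_const, along_const_mul (hs 1),
    along_const_mul (hs 2), along_const_mul ((hs 0).sub (hs 3)),
    along_const_mul ((hs 0).add (hs 3)), along_add (hs 0) (hs 3), along_sub (hs 0) (hs 3)]
  have hr := sqrt_two_inv_sq
  generalize (√2)⁻¹ = r at hr
  apply Complex.ext
  · simp [Fin.sum_univ_four, sgn]
    linear_combination (2 * along (e 0) (along (e 0) φ) x - 2 * along (e 3) (along (e 3) φ) x
      - 2 * along (e 1) (along (e 1) φ) x - 2 * along (e 2) (along (e 2) φ) x) * hr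
  · simp
    ring

end FirstOrder

/-! ### Spin coefficients in the orthonormal frame -/

lemma cov_tetL (he : IsOrthonormalFrame g e) (cov : Connection M) (x : M)
    (v : TangentSpace (𝓡 4) x) : cov (tetL e) x v = (√2)⁻¹ • (cov (e 0) x v + cov (e 3) x v) := by
  unfold tetL
  rw [cov_const_smul cov _ ((he.smooth 0).add (he.smooth 3)),
    cov_add cov (he.smooth 0) (he.smooth 3)]
  rfl

lemma cov_tetN (he : IsOrthonormalFrame g e) (cov : Connection M) (x : M)
    (v : TangentSpace (𝓡 4) x) : cov (tetN e) x v = (√2)⁻¹ • (cov (e 0) x v - cov (e 3) x v) := by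
  have h1 : tetN e = fun y ↦ (√2)⁻¹ • (e 0 y + (-1 : ℝ) • e 3 y) := by
    funext y; simp only [tetN]; module
  have h3 : SmoothVField (fun y ↦ (-1 : ℝ) • e 3 y) := (smoothFn_const (-1)).smul (he.smooth 3)
  rw [h1, cov_const_smul cov _ ((he.smooth 0).add h3), cov_add cov (he.smooth 0) h3,
    cov_const_smul cov _ (he.smooth 3)]
  simp only [smul_apply, add_apply]
  module

lemma cov_tetM_re (he : IsOrthonormalFrame g e) (cov : Connection M) (x : M)
    (v : TangentSpace (𝓡 4) x) : cov (tetM e).re x v = (√2)⁻¹ • cov (e 1) x v := by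
  simp only [tetM]
  rw [cov_const_smul cov _ (he.smooth 1)]
  rfl

lemma cov_tetM_im (he : IsOrthonormalFrame g e) (cov : Connection M) (x : M)
    (v : TangentSpace (𝓡 4) x) : cov (tetM e).im x v = -((√2)⁻¹ • cov (e 2) x v) := by
  have h1 : (tetM e).im = fun y ↦ (-(√2)⁻¹) • e 2 y := by
    funext y; simp only [tetM]; module
  rw [h1, cov_const_smul cov _ (he.smooth 2)]
  simp only [smul_apply]
  module

lemma cov_zero_field (cov : Connection M) (x : M) (v : TangentSpace (𝓡 4) x) :
    cov (fun _ ↦ 0) x v = 0 :=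
  DFunLike.congr_fun (cov.isCovariantDerivativeOnUniv.zero (x := x)) v

/-- The connection coefficients `g(∇_{eᵢ} eⱼ, eₖ)`. -/
noncomputable def connCoeff (g : LorentzMetric M) (cov : Connection M) (e : Fin 4 → VField M)
    (x : M) (i j k : Fin 4) : ℝ := g.val x (e k x) (cov (e j) x (e i x))

lemma connCoeff_skew (h : IsLeviCivita g cov) (he : IsOrthonormalFrame g e) (x : M)
    (i j k : Fin 4) : connCoeff g cov e x i j k = -connCoeff g cov e x i k j := by
  simp only [connCoeff, g.symm x (e k x), g.symm x (e j x)]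
  exact connection_skew h he x _ j k

lemma divergence_frame (x : M) (k : Fin 4) :
    divergence g cov e (e k) x = ∑ i, sgn i * connCoeff g cov e x i k i := by
  simp only [divergence, connCoeff, g.symm x (e _ x)]

/-- As `l` is a constant multiple of `e₀ + e₃`, its parallelism means `∇e₀ = -∇e₃`. -/
lemma IsParallel.connCoeff_tetL (he : IsOrthonormalFrame g e) (hl : IsParallel cov (tetL e))
    (x : M) (i k : Fin 4) : connCoeff g cov e x i 0 k = -connCoeff g cov e x i 3 k := by
  have h1 := cov_tetL he cov x (e i x)
  rw [hl x] at h1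
  have h2 := (smul_eq_zero.1 h1.symm).resolve_left (by positivity)
  simp only [connCoeff, eq_neg_of_add_eq_zero_left h2, map_neg]

lemma IsParallel.connCoeff_tetN (he : IsOrthonormalFrame g e) (hn : IsParallel cov (tetN e))
    (x : M) (i k : Fin 4) : connCoeff g cov e x i 0 k = connCoeff g cov e x i 3 k := by
  have h1 := cov_tetN he cov x (e i x)
  rw [hn x] at h1
  have h2 := (smul_eq_zero.1 h1.symm).resolve_left (by positivity)
  simp only [connCoeff, sub_eq_zero.1 h2]

lemma cinner_ccov (g : LorentzMetric M) (cov : Connection M) (Z W U : CField M) (x : M) :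
    cinner g Z (ccov cov W U) x =
      ⟨g.val x (Z.re x) (cov U.re x (W.re x)) - g.val x (Z.re x) (cov U.im x (W.im x))
        - g.val x (Z.im x) (cov U.im x (W.re x)) - g.val x (Z.im x) (cov U.re x (W.im x)),
      g.val x (Z.re x) (cov U.im x (W.re x)) + g.val x (Z.re x) (cov U.re x (W.im x))
        + g.val x (Z.im x) (cov U.re x (W.re x)) - g.val x (Z.im x) (cov U.im x (W.im x))⟩ := by
  simp only [cinner, ccov, map_add, map_sub]
  apply Complex.ext <;> ring

/-- Each tetrad vector brings one factor `1/√2`, and a spin coefficient involves three of them;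
hence the cube here and in the formulas that follow. -/
lemma npMu_eq (he : IsOrthonormalFrame g e) (cov : Connection M) (x : M) :
    letI G := connCoeff g cov e x
    npMu g cov e x = ⟨-(√2)⁻¹ ^ 3 * ((G 1 0 1 - G 1 3 1) + (G 2 0 2 - G 2 3 2)),
      -(√2)⁻¹ ^ 3 * ((G 1 0 2 - G 1 3 2) - (G 2 0 1 - G 2 3 1))⟩ := by
  simp only [npMu, cinner_ccov, tetMbar, CField.conj, cN, CField.ofReal, cov_tetN he,
    cov_zero_field]
  apply Complex.ext <;>
  · simp [tetM, connCoeff]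
    ring

lemma npPi_eq (he : IsOrthonormalFrame g e) (cov : Connection M) (x : M) :
    letI G := connCoeff g cov e x
    npPi g cov e x = ⟨-(√2)⁻¹ ^ 3 * ((G 0 0 1 - G 0 3 1) + (G 3 0 1 - G 3 3 1)),
      -(√2)⁻¹ ^ 3 * ((G 0 0 2 - G 0 3 2) + (G 3 0 2 - G 3 3 2))⟩ := by
  simp only [npPi, cinner_ccov, tetMbar, CField.conj, cL, cN, CField.ofReal, cov_tetN he,
    cov_zero_field]
  apply Complex.ext <;>
  · simp [tetM, tetL, connCoeff]
    ring

lemma npRho_eq (he : IsOrthonormalFrame g e) (cov : Connection M) (x : M) :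
    letI G := connCoeff g cov e x
    npRho g cov e x = ⟨(√2)⁻¹ ^ 3 * ((G 1 0 1 + G 1 3 1) + (G 2 0 2 + G 2 3 2)),
      (√2)⁻¹ ^ 3 * ((G 2 0 1 + G 2 3 1) - (G 1 0 2 + G 1 3 2))⟩ := by
  simp only [npRho, cinner_ccov, tetMbar, CField.conj, cL, CField.ofReal, cov_tetL he,
    cov_zero_field]
  apply Complex.ext <;>
  · simp [tetM, connCoeff]
    ring

lemma npTau_eq (he : IsOrthonormalFrame g e) (cov : Connection M) (x : M) :
    letI G := connCoeff g cov e x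
    npTau g cov e x = ⟨(√2)⁻¹ ^ 3 * ((G 0 0 1 + G 0 3 1) - (G 3 0 1 + G 3 3 1)),
      -(√2)⁻¹ ^ 3 * ((G 0 0 2 + G 0 3 2) - (G 3 0 2 + G 3 3 2))⟩ := by
  simp only [npTau, cinner_ccov, cL, cN, CField.ofReal, cov_tetL he, cov_zero_field]
  apply Complex.ext <;>
  · simp [tetM, tetN, connCoeff]
    ring

lemma npAlpha_eq (he : IsOrthonormalFrame g e) (cov : Connection M) (x : M) :
    letI G := connCoeff g cov e x
    npAlpha g cov e x = ⟨(√2)⁻¹ ^ 3 * ((G 1 0 0 + G 1 3 0) - (G 1 0 3 + G 1 3 3)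
        - (G 1 1 1 + G 2 2 1 - G 2 1 2 + G 1 2 2)) / 2,
      (√2)⁻¹ ^ 3 * ((G 2 0 0 + G 2 3 0) - (G 2 0 3 + G 2 3 3)
        - (G 2 1 1 - G 1 2 1 + G 1 1 2 + G 2 2 2)) / 2⟩ := by
  simp only [npAlpha, cinner_ccov, tetMbar, CField.conj, cL, cN, CField.ofReal, cov_tetL he,
    cov_tetM_re he, cov_tetM_im he, cov_zero_field]
  apply Complex.ext <;>
  · simp [tetM, tetN, connCoeff]
    ring

/-- For parallel `l` the operator `etaOp` is the massive scalar wave operator. -/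
lemma etaOp_ofReal (h : IsLeviCivita g cov) (he : IsOrthonormalFrame g e)
    (hl : IsParallel cov (tetL e)) (mass : ℝ) {φ : M → ℝ} (hφ : SmoothFn φ) (x : M) :
    etaOp g cov e mass (fun y ↦ (φ y : ℂ)) x
      = ((scalarWave g cov e φ x + mass ^ 2 * φ x : ℝ) : ℂ) := by
  rw [etaOp, second_order_part he hφ, scalarWave, opD_ofReal hφ, opdelta_ofReal hφ,
    opdeltaBar_ofReal hφ, npMu_eq he, npAlpha_eq he, npPi_eq he]
  simp only [divergence_frame]
  have hskew : ∀ i j k, connCoeff g cov e x i j k = -connCoeff g cov e x i k j :=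
    connCoeff_skew h he x
  have hpar := IsParallel.connCoeff_tetL he hl x
  generalize connCoeff g cov e x = G at hskew hpar
  -- Skewness and `∇e₀ = -∇e₃` leave only `G i 0 1`, `G i 0 2` and `G i 1 2` as independent
  -- coefficients.
  have hdiag : ∀ i j, G i j j = 0 := fun i j ↦ by linarith [hskew i j j]
  have h10 : ∀ i, G i 1 0 = -G i 0 1 := fun i ↦ hskew i 1 0
  have h20 : ∀ i, G i 2 0 = -G i 0 2 := fun i ↦ hskew i 2 0
  have h21 : ∀ i, G i 2 1 = -G i 1 2 := fun i ↦ hskew i 2 1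
  have h03 : ∀ i, G i 0 3 = 0 := fun i ↦ by rw [hpar, hdiag, neg_zero]
  have h31 : ∀ i, G i 3 1 = -G i 0 1 := fun i ↦ by rw [hpar, neg_neg]
  have h32 : ∀ i, G i 3 2 = -G i 0 2 := fun i ↦ by rw [hpar, neg_neg]
  have h13 : ∀ i, G i 1 3 = G i 0 1 := fun i ↦ by rw [hskew, h31, neg_neg]
  have h23 : ∀ i, G i 2 3 = G i 0 2 := fun i ↦ by rw [hskew, h32, neg_neg]
  have h30 : ∀ i, G i 3 0 = 0 := fun i ↦ by rw [hskew, h03, neg_zero]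
  -- Three factors `1/√2` come from the spin coefficient and a fourth from the tetrad derivative of
  -- `φ`.
  have hr : (√2)⁻¹ ^ 4 = (4⁻¹ : ℝ) := by
    rw [show (√2)⁻¹ ^ 4 = ((√2)⁻¹ ^ 2) ^ 2 by ring, sqrt_two_inv_sq]; norm_num
  generalize (√2)⁻¹ = r at hr
  simp only [hdiag, h10, h20, h21, h31, h32, h13, h23, h03, h30, Fin.sum_univ_four]
  apply Complex.ext
  · simp [sgn, ← Complex.ofReal_pow]
    -- The multiplier of `hr` is four times `∑ sgn(i) (div eᵢ) eᵢ φ` in the remaining coefficients.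
    linear_combination 4 * ((-G 1 0 1 - G 2 0 2) * along (e 0) φ x
      - (-G 0 0 1 - G 2 1 2 - G 3 0 1) * along (e 1) φ x
      - (-G 0 0 2 + G 1 1 2 - G 3 0 2) * along (e 2) φ x
      - (G 1 0 1 + G 2 0 2) * along (e 3) φ x) * hr
  · simp [sgn, ← Complex.ofReal_pow]
    ring

/-- For parallel `n` the operator `xiOp` is the massive scalar wave operator. -/
lemma xiOp_ofReal (h : IsLeviCivita g cov) (he : IsOrthonormalFrame g e)
    (hn : IsParallel cov (tetN e)) (mass : ℝ) {φ : M → ℝ} (hφ : SmoothFn φ) (x : M) :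
    xiOp g cov e mass (fun y ↦ (φ y : ℂ)) x
      = ((scalarWave g cov e φ x + mass ^ 2 * φ x : ℝ) : ℂ) := by
  rw [xiOp, second_order_part he hφ, scalarWave, opDelta_ofReal hφ, opdelta_ofReal hφ,
    opdeltaBar_ofReal hφ, npRho_eq he, npAlpha_eq he, npTau_eq he]
  simp only [divergence_frame]
  have hskew : ∀ i j k, connCoeff g cov e x i j k = -connCoeff g cov e x i k j :=
    connCoeff_skew h he x
  have hpar := IsParallel.connCoeff_tetN he hn x
  generalize connCoeff g cov e x = G at hskew hpar
  have hdiag : ∀ i j, G i j j = 0 := fun i j ↦ by linarith [hskew i j j]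
  -- The reduction is the same as for `l`, with `∇e₀ = ∇e₃` in place of `∇e₀ = -∇e₃`.
  have h10 : ∀ i, G i 1 0 = -G i 0 1 := fun i ↦ hskew i 1 0
  have h20 : ∀ i, G i 2 0 = -G i 0 2 := fun i ↦ hskew i 2 0
  have h21 : ∀ i, G i 2 1 = -G i 1 2 := fun i ↦ hskew i 2 1
  have h03 : ∀ i, G i 0 3 = 0 := fun i ↦ by rw [hpar, hdiag]
  have h31 : ∀ i, G i 3 1 = G i 0 1 := fun i ↦ by rw [hpar]
  have h32 : ∀ i, G i 3 2 = G i 0 2 := fun i ↦ by rw [hpar]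
  have h13 : ∀ i, G i 1 3 = -G i 0 1 := fun i ↦ by rw [hskew, h31]
  have h23 : ∀ i, G i 2 3 = -G i 0 2 := fun i ↦ by rw [hskew, h32]
  have h30 : ∀ i, G i 3 0 = 0 := fun i ↦ by rw [hskew, h03, neg_zero]
  have hr : (√2)⁻¹ ^ 4 = (4⁻¹ : ℝ) := by
    rw [show (√2)⁻¹ ^ 4 = ((√2)⁻¹ ^ 2) ^ 2 by ring, sqrt_two_inv_sq]; norm_num
  generalize (√2)⁻¹ = r at hr
  simp only [hdiag, h10, h20, h21, h31, h32, h13, h23, h03, h30, Fin.sum_univ_four]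
  apply Complex.ext
  · simp [sgn, ← Complex.ofReal_pow]
    linear_combination 4 * ((-G 1 0 1 - G 2 0 2) * along (e 0) φ x
      - (-G 0 0 1 - G 2 1 2 + G 3 0 1) * along (e 1) φ x
      - (-G 0 0 2 + G 1 1 2 + G 3 0 2) * along (e 2) φ x
      - (-G 1 0 1 - G 2 0 2) * along (e 3) φ x) * hr
  · simp [sgn, ← Complex.ofReal_pow]
    ring

end NewmanPenrose

section Decoupling

variable {g : LorentzMetric M} {cov : Connection M} {e : Fin 4 → VField M}

/-! ### Components in the null tetrad -/

/-- The tetrad combination is invariant under conjugation, so its imaginary part vanishes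
identically. Uniqueness of frame coefficients reduces the rest to four linear equations. -/
lemma isNPDecomposition_iff (he : IsOrthonormalFrame g e) {A : VField M} {a : Fin 4 → M → ℝ}
    (ha : ∀ x, A x = ∑ i, a i x • e i x) (ξ η : M → ℝ) (ζ : M → ℂ) :
    IsNPDecomposition e A ξ η ζ ↔
      ∀ x, ξ x = (a 0 x + a 3 x) / √2 ∧ η x = (a 0 x - a 3 x) / √2 ∧
        ζ x = ((a 1 x : ℂ) - Complex.I * a 2 x) / (√2 : ℝ) := by
  have hr : √2 * √2 = (2 : ℝ) := Real.mul_self_sqrt (by norm_num)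
  have hr0 : √2 ≠ (0 : ℝ) := by positivity
  -- In this form `module` can see that twice `1/√2` is `√2`.
  have hinv : (√2)⁻¹ = √2 / (2 : ℝ) := by field_simp; linarith
  -- The middle entries come from `ζ̄ m + ζ m̄ = 2 Re (ζ̄ m)` with `m = (e₁ - i e₂)/√2`.
  let b : M → Fin 4 → ℝ := fun x ↦
    ![(√2)⁻¹ * (ξ x + η x), √2 * (ζ x).re, -(√2 * (ζ x).im), (√2)⁻¹ * (ξ x - η x)]
  have hre : ∀ x, ((((CField.smul (fun x ↦ (ξ x : ℂ)) (cL e)).add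
      (CField.smul (fun x ↦ (η x : ℂ)) (cN e))).add
      (CField.smul (fun x ↦ (starRingEnd ℂ) (ζ x)) (tetM e))).add
      (CField.smul ζ (tetMbar e))).re x = ∑ i, b x i • e i x := by
    intro x
    simp only [CField.add, CField.smul, cL, cN, CField.ofReal, tetL, tetN, tetM, tetMbar,
      CField.conj, Complex.ofReal_re, Complex.ofReal_im, Complex.conj_re, Complex.conj_im,
      Fin.sum_univ_four, b, hinv, Matrix.cons_val]
    module
  have him : ∀ x, ((((CField.smul (fun x ↦ (ξ x : ℂ)) (cL e)).add
      (CField.smul (fun x ↦ (η x : ℂ)) (cN e))).add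
      (CField.smul (fun x ↦ (starRingEnd ℂ) (ζ x)) (tetM e))).add
      (CField.smul ζ (tetMbar e))).im x = 0 := by
    intro x
    simp only [CField.add, CField.smul, cL, cN, CField.ofReal, tetL, tetN, tetM, tetMbar,
      CField.conj, Complex.ofReal_re, Complex.ofReal_im, Complex.conj_re, Complex.conj_im]
    module
  have hiff : IsNPDecomposition e A ξ η ζ ↔ ∀ x, (fun i ↦ a i x) = b x := by
    rw [IsNPDecomposition, CField.ext_iff]
    constructor
    · rintro ⟨h1, -⟩ x
      refine he.coeff_ext (x := x) ?_
      rw [← ha x, ← hre x]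
      exact congrFun h1 x
    · intro h1
      refine ⟨funext fun x ↦ ?_, funext fun x ↦ (him x).symm⟩
      rw [hre x, ← h1 x]
      exact ha x
  rw [hiff]
  refine forall_congr' fun x ↦ ?_
  rw [funext_iff, Fin.forall_fin_succ, Fin.forall_fin_succ, Fin.forall_fin_succ,
    Fin.forall_fin_one]
  have hζ : ζ x = ((a 1 x : ℂ) - Complex.I * a 2 x) / (√2 : ℝ) ↔
      (ζ x).re = a 1 x / √2 ∧ (ζ x).im = -a 2 x / √2 := by
    rw [Complex.ext_iff, Complex.div_ofReal_re, Complex.div_ofReal_im]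
    simp
  rw [hζ]
  change a 0 x = (√2)⁻¹ * (ξ x + η x) ∧ a 1 x = √2 * (ζ x).re ∧ a 2 x = -(√2 * (ζ x).im) ∧
    a 3 x = (√2)⁻¹ * (ξ x - η x) ↔ _
  rw [hinv]
  simp only [eq_div_iff hr0]
  constructor
  · rintro ⟨h0, h1, h2, h3⟩
    rw [h0, h1, h2, h3]
    refine ⟨?_, ?_, ?_, ?_⟩ <;> ring
  · rintro ⟨h0, h1, h2, h3⟩
    refine ⟨?_, ?_, ?_, ?_⟩ <;> linarith

lemma smooth_coeff (he : IsOrthonormalFrame g e) {A : VField M} (hA : SmoothVField A)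
    {a : Fin 4 → M → ℝ} (ha : ∀ x, A x = ∑ i, a i x • e i x) (k : Fin 4) : SmoothFn (a k) := by
  have : a k = fun x ↦ sgn k * g.val x (A x) (e k x) := by
    funext x; rw [ha x, he.inner_sum, ← mul_assoc, sgn_mul_self, one_mul]
  rw [this]
  exact (smoothFn_const _).mul (hA.inner (he.smooth k))

lemma IsOrthonormalFrame.smooth_tetL (he : IsOrthonormalFrame g e) : SmoothVField (tetL e) :=
  (smoothFn_const _).smul ((he.smooth 0).add (he.smooth 3))

lemma IsOrthonormalFrame.smooth_tetN (he : IsOrthonormalFrame g e) : SmoothVField (tetN e) :=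
  (smoothFn_const _).smul ((he.smooth 0).sub (he.smooth 3))

lemma IsOrthonormalFrame.inner_tetL (he : IsOrthonormalFrame g e) {A : VField M}
    {a : Fin 4 → M → ℝ} (ha : ∀ x, A x = ∑ i, a i x • e i x) (x : M) :
    g.val x (tetL e x) (A x) = (a 0 x - a 3 x) / √2 := by
  rw [g.symm, tetL, map_smul, map_add, ha x, he.inner_sum, he.inner_sum]
  simp [sgn]; ring

lemma IsOrthonormalFrame.inner_tetN (he : IsOrthonormalFrame g e) {A : VField M}
    {a : Fin 4 → M → ℝ} (ha : ∀ x, A x = ∑ i, a i x • e i x) (x : M) :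
    g.val x (tetN e x) (A x) = (a 0 x + a 3 x) / √2 := by
  rw [g.symm, tetN, map_smul, map_sub, ha x, he.inner_sum, he.inner_sum]
  simp [sgn]; ring

/-! ### The decoupled equations -/

lemma scalarWave_const_mul (he : IsOrthonormalFrame g e) (cov : Connection M) (c : ℝ)
    {φ : M → ℝ} (hφ : SmoothFn φ) (x : M) :
    scalarWave g cov e (fun y ↦ c * φ y) x = c * scalarWave g cov e φ x := by
  have h1 : ∀ i, along (e i) (fun y ↦ c * φ y) = fun y ↦ c * along (e i) φ y := fun i ↦
    funext fun y ↦ along_const_mul hφ c y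
  simp only [scalarWave, h1, mul_add, Finset.mul_sum,
    fun i ↦ along_const_mul (X := e i) (he.smooth_along (he.smooth i) hφ) c x]
  congr 1 <;> exact Finset.sum_congr rfl fun i _ ↦ by ring

/-- Contraction of the massive wave operator with a parallel field. -/
lemma inner_massive_wave (h : IsLeviCivita g cov) (he : IsOrthonormalFrame g e) {Y A : VField M}
    (hY : SmoothVField Y) (hpar : IsParallel cov Y) (hA : SmoothVField A) (mass : ℝ)
    {φ : M → ℝ} (hφ : ∀ y, g.val y (Y y) (A y) = φ y) (x : M) :
    g.val x (Y x) (waveOp cov e A x + mass ^ 2 • A x)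
      = scalarWave g cov e φ x + mass ^ 2 * φ x := by
  rw [map_add, map_smul, inner_waveOp h he hY hpar hA, funext hφ, hφ x, smul_eq_mul]

/-- Contraction yields the equation for `η` or `ξ`; linearity removes their factor `1/√2`. -/
lemma scalarWave_eq_zero_of_div (he : IsOrthonormalFrame g e) (cov : Connection M) (mass : ℝ)
    {φ : M → ℝ} (hφ : SmoothFn φ) {x : M}
    (h0 : scalarWave g cov e (fun y ↦ φ y / √2) x + mass ^ 2 * (φ x / √2) = 0) :
    scalarWave g cov e φ x + mass ^ 2 * φ x = 0 := by
  have h1 : (fun y ↦ φ y / √2) = fun y ↦ (√2)⁻¹ * φ y := funext fun y ↦ div_eq_inv_mul _ _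
  rw [h1, scalarWave_const_mul he cov _ hφ, div_eq_inv_mul] at h0
  have hr0 : (√2)⁻¹ ≠ (0 : ℝ) := by positivity
  apply mul_left_cancel₀ hr0
  linarith

end Decoupling

end ProcaNP

theorem mainTheorem2 {M : Type*} [TopologicalSpace M]
    [ChartedSpace (EuclideanSpace ℝ (Fin 4)) M] [IsManifold (𝓡 4) ∞ M]
    (g : ProcaNP.LorentzMetric M) (cov : ProcaNP.Connection M)
    (hcov : ProcaNP.IsLeviCivita g cov)
    (e : Fin 4 → ProcaNP.VField M) (he : ProcaNP.IsOrthonormalFrame g e)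
    (mass : ℝ) (A : ProcaNP.VField M) (hA : ProcaNP.SmoothVField A)
    -- the components of `A` in the orthonormal frame
    (a : Fin 4 → M → ℝ) (ha : ∀ x, A x = ∑ i, a i x • e i x) :
    -- the components of `A` in the null tetrad
    (∀ (ξ η : M → ℝ) (ζ : M → ℂ), ProcaNP.IsNPDecomposition e A ξ η ζ ↔
      ∀ x, ξ x = (a 0 x + a 3 x) / √2 ∧ η x = (a 0 x - a 3 x) / √2 ∧
        ζ x = ((a 1 x : ℂ) - Complex.I * a 2 x) / (√2 : ℝ)) ∧
    -- `∇l = 0`: decoupled equation for `A⁰ - A³`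
    (ProcaNP.IsParallel cov (ProcaNP.tetL e) →
      (∀ x, ((g.val x (ProcaNP.tetL e x)
            (ProcaNP.waveOp cov e A x + mass ^ 2 • A x) : ℝ) : ℂ)
          = ProcaNP.etaOp g cov e mass (fun y ↦ (((a 0 y - a 3 y) / √2 : ℝ) : ℂ)) x) ∧
      (ProcaNP.IsMassiveWave cov e mass A →
        ∀ x, ProcaNP.etaOp g cov e mass (fun y ↦ ((a 0 y - a 3 y : ℝ) : ℂ)) x = 0) ∧
      (mass ≠ 0 → ProcaNP.IsProcaField g cov e mass A →
        ∀ x, ProcaNP.etaOp g cov e mass (fun y ↦ ((a 0 y - a 3 y : ℝ) : ℂ)) x = 0)) ∧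
    -- `∇n = 0`: decoupled equation for `A⁰ + A³`
    (ProcaNP.IsParallel cov (ProcaNP.tetN e) →
      (∀ x, ((g.val x (ProcaNP.tetN e x)
            (ProcaNP.waveOp cov e A x + mass ^ 2 • A x) : ℝ) : ℂ)
          = ProcaNP.xiOp g cov e mass (fun y ↦ (((a 0 y + a 3 y) / √2 : ℝ) : ℂ)) x) ∧
      (ProcaNP.IsMassiveWave cov e mass A →
        ∀ x, ProcaNP.xiOp g cov e mass (fun y ↦ ((a 0 y + a 3 y : ℝ) : ℂ)) x = 0) ∧
      (mass ≠ 0 → ProcaNP.IsProcaField g cov e mass A →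
        ∀ x, ProcaNP.xiOp g cov e mass (fun y ↦ ((a 0 y + a 3 y : ℝ) : ℂ)) x = 0)) := by
  open ProcaNP in
  have hs := smooth_coeff he hA ha
  have hdiv : ∀ {φ : M → ℝ}, SmoothFn φ → SmoothFn (fun y ↦ φ y / √2) := fun hφ ↦ by
    simpa only [div_eq_mul_inv] using hφ.mul (smoothFn_const _)
  refine ⟨isNPDecomposition_iff he ha, fun hl ↦ ?_, fun hn ↦ ?_⟩
  · have hφ := (hs 0).sub (hs 3)
    have key := inner_massive_wave hcov he he.smooth_tetL hl hA mass (he.inner_tetL ha)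
    refine ⟨fun x ↦ ?_, fun hw x ↦ ?_, fun hm hP x ↦ ?_⟩
    · rw [etaOp_ofReal hcov he hl mass (hdiv hφ), key]
    · rw [etaOp_ofReal hcov he hl mass hφ, Complex.ofReal_eq_zero]
      refine scalarWave_eq_zero_of_div he cov mass hφ ?_
      rw [← key, hw x, map_zero]
    · rw [etaOp_ofReal hcov he hl mass hφ, Complex.ofReal_eq_zero]
      refine scalarWave_eq_zero_of_div he cov mass hφ ?_
      rw [← key, hP.inner_waveOp_eq_zero hcov he hm hA he.smooth_tetL hl]
  · have hφ := (hs 0).add (hs 3)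
    have key := inner_massive_wave hcov he he.smooth_tetN hn hA mass (he.inner_tetN ha)
    refine ⟨fun x ↦ ?_, fun hw x ↦ ?_, fun hm hP x ↦ ?_⟩
    · rw [xiOp_ofReal hcov he hn mass (hdiv hφ), key]
    · rw [xiOp_ofReal hcov he hn mass hφ, Complex.ofReal_eq_zero]
      refine scalarWave_eq_zero_of_div he cov mass hφ ?_
      rw [← key, hw x, map_zero]
    · rw [xiOp_ofReal hcov he hn mass hφ, Complex.ofReal_eq_zero]
      refine scalarWave_eq_zero_of_div he cov mass hφ ?_
      rw [← key, hP.inner_waveOp_eq_zero hcov he hm hA he.smooth_tetN hn]
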